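/- **Proposition 8.1.** All manifolds, metrics and tensor fields are smooth; manifolds are Hausdorff, second countable and without boundary; $d\eta(X,Y)=X\eta(Y)-Y\eta(X)-\eta([X,Y])$ for a 1-form $\eta$. Let $(M,g)$ be a Riemannian manifold. A *contact metric structure* compatible with $g$ is a triple $(\eta,\xi,\Phi)$ of a contact form $\eta$ (a nowhere vanishing 1-form with $d\eta$ nondegenerate on $\ker\eta$), its Reeb vector field $\xi$ ($\eta(\xi)=1$, $d\eta(\xi,\cdot)=0$) and a section $\Phi$ of $\operatorname{End}TM$ such that, for all vector fields $X,Y$, $$\Phi^2=-\mathrm{id}+\xi\otimes\eta,\qquad g(\Phi X,\Phi Y)=g(X,Y)-\eta(X)\eta(Y),\qquad \tfrac12\,d\eta(X,\Phi Y)=g(X,Y)-\eta(X)\eta(Y).$$ It is *normal* if $[\Phi X,\Phi Y]+\Phi^2[X,Y]-\Phi[X,\Phi Y]-\Phi[\Phi X,Y]=-d\eta(X,Y)\,\xi$ for all $X,Y$. A *compatible contact 3-structure* on $(M,g)$ is a triple $(\eta^a,\xi^a,\Phi^a)_{a=1,2,3}$ of contact metric structures compatible with the same metric $g$ such that $$\Phi^a\circ\Phi^b-\xi^a\otimes\eta^b=-\sum_{c}\epsilon^{abc}\Phi^c-\delta^{ab}\,\mathrm{id}\qquad(a,b=1,2,3),$$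 where $\epsilon^{abc}$ is the totally antisymmetric symbol with $\epsilon^{123}=1$. $(M,g)$ is *3-Sasakian* if it has a compatible contact 3-structure all three members of which are normal. A Riemannian manifold $(N,h)$ is *almost hyperkähler* if it has three $h$-orthogonal almost complex structures $J^1,J^2,J^3$ with $J^a\circ J^b=\sum_c\epsilon^{abc}J^c-\delta^{ab}\,\mathrm{id}$ whose fundamental 2-forms $\omega^a=h(\cdot,J^a\cdot)$ are all closed; it is *hyperkähler* if they can moreover be chosen integrable, i.e. with vanishing Nijenhuis tensors. Let $C(M)=M\times\mathbb R^+$ with the cone metric $dr^2+r^2g$. Then $(M,g)$ has a compatible contact 3-structure if and only if $(C(M),dr^2+r^2g)$ is almost hyperkähler. Furthermore, $(M,g)$ is 3-Sasakian if and only if $(C(M),dr^2+r^2g)$ is hyperkähler. -/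

import Mathlib

open scoped Manifold ContDiff
open Bornology

noncomputable section

section ConeMetric

variable {E : Type*} [NormedAddCommGroup E] [NormedSpace ℝ E]
  {H : Type*} [TopologicalSpace H] {I : ModelWithCorners ℝ E H}
  {M : Type*} [TopologicalSpace M] [ChartedSpace H M]

/-- The open half-line `ℝ⁺ = (0, ∞)`, as an open submanifold of `ℝ`. -/
def PosReal : TopologicalSpace.Opens ℝ := ⟨Set.Ioi 0, isOpen_Ioi⟩

/-- The cone `C(M) = M × ℝ⁺`, with its product manifold structure. -/
abbrev Cone (M : Type*) : Type _ := M × PosReal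

variable (I) in
/-- The model with corners of `C(M)`, for `M` modelled on `I`. -/
abbrev coneModel : ModelWithCorners ℝ (E × ℝ) (ModelProd H ℝ) := I.prod 𝓘(ℝ, ℝ)

/-- The radial coordinate `r` on the cone. -/
def coneRadius (p : Cone M) : ℝ := (p.2 : ℝ)

variable (I) in
/-- The differential at `p` of the projection `C(M) → M`. -/
def coneProjDeriv (p : Cone M) : TangentSpace (coneModel I) p →L[ℝ] TangentSpace I p.1 :=
  mfderiv (coneModel I) I (Prod.fst : Cone M → M) p

variable (I) in
/-- The 1-form `dr` on the cone. -/
def coneDr (p : Cone M) : TangentSpace (coneModel I) p →L[ℝ] ℝ :=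
  mfderiv (coneModel I) 𝓘(ℝ, ℝ) (coneRadius : Cone M → ℝ) p

theorem hasMFDerivAt_posReal_val (r : PosReal) :
    HasMFDerivAt 𝓘(ℝ, ℝ) 𝓘(ℝ, ℝ) (Subtype.val : PosReal → ℝ) r
      (ContinuousLinearMap.id ℝ ℝ) := by
  refine ⟨continuous_subtype_val.continuousAt, ?_⟩
  refine (hasFDerivWithinAt_id _ _).congr_of_eventuallyEq ?_ ?_
  · have h := TopologicalSpace.Opens.chartAt_subtype_val_symm_eventuallyEq PosReal (H := ℝ) (x := r)
    have h2 : (fun x : ℝ => ((chartAt ℝ r).symm x : ℝ)) =ᶠ[nhdsWithin (r : ℝ) Set.univ] id := by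
      rw [nhdsWithin_univ]
      exact h.symm
    have e1 : writtenInExtChartAt 𝓘(ℝ, ℝ) 𝓘(ℝ, ℝ) r (Subtype.val : PosReal → ℝ) =
        fun x : ℝ ↦ ((chartAt ℝ r).symm x : ℝ) := by
      ext x
      simp [writtenInExtChartAt, extChartAt]
      rfl
    have e2 : extChartAt 𝓘(ℝ, ℝ) r r = (r : ℝ) := by
      simp [extChartAt]
      rfl
    have e3 : Set.range 𝓘(ℝ, ℝ) = Set.univ := by simp
    rw [e1, e2, e3]
    exact h2
  · simp
    rfl

theorem coneProjDeriv_apply (p : Cone M) (v : TangentSpace (coneModel I) p) :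
    coneProjDeriv I p v = v.1 := by
  rw [coneProjDeriv, mfderiv_fst]
  rfl

theorem contMDiff_coneRadius : ContMDiff (coneModel I) 𝓘(ℝ, ℝ) ∞ (coneRadius : Cone M → ℝ) :=
  contMDiff_subtype_val.comp contMDiff_snd

theorem coneDr_apply (p : Cone M) (v : TangentSpace (coneModel I) p) :
    coneDr I p v = v.2 := by
  have := (hasMFDerivAt_posReal_val p.2).comp p (hasMFDerivAt_snd (I := I) (I' := 𝓘(ℝ,ℝ)) p)
  have h2 := this.mfderiv
  rw [coneDr]
  erw [h2]
  rfl

/-- The bilinear form `dr² + r² g` on the tangent space of the cone at `p`. -/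
def coneInner [IsManifold I ∞ M]
    (g : Bundle.ContMDiffRiemannianMetric I ∞ E (fun x : M ↦ TangentSpace I x)) (p : Cone M) :
    TangentSpace (coneModel I) p →L[ℝ] TangentSpace (coneModel I) p →L[ℝ] ℝ :=
  (coneDr I p).smulRight (coneDr I p) +
  coneRadius p ^ 2 • ((ContinuousLinearMap.precomp ℝ (coneProjDeriv I p)).comp ((g.inner p.1).comp (coneProjDeriv I p)))

variable [IsManifold I ∞ M] (g : Bundle.ContMDiffRiemannianMetric I ∞ E (fun x : M ↦ TangentSpace I x))

theorem coneInner_apply (p : Cone M) (v w) : coneInner g p v w = coneDr I p v * coneDr I p w +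
  coneRadius p ^ 2 * g.inner p.1 (coneProjDeriv I p v) (coneProjDeriv I p w) := by
  simp [coneInner]

theorem coneInner_apply_coord (p : Cone M) (v w : TangentSpace (coneModel I) p) :
    coneInner g p v w = v.2 * w.2 + coneRadius p ^ 2 * g.inner p.1 v.1 w.1 := by
  rw [coneInner_apply, coneDr_apply, coneDr_apply, coneProjDeriv_apply, coneProjDeriv_apply]

theorem riemannianMetric_self_nonneg (x : M) (v : TangentSpace I x) : 0 ≤ g.inner x v v := by
  by_cases h : v = 0
  · rw [h]; simp
  · exact (g.pos _ _ h).le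

theorem riemannianMetric_smul_self (x : M) (c : ℝ) (v : TangentSpace I x) :
    g.inner x (c • v) (c • v) = c ^ 2 * g.inner x v v := by
  rw [map_smul, map_smul, smul_apply, smul_eq_mul, smul_eq_mul]
  ring

theorem coneInner_isVonNBounded (p : Cone M) : IsVonNBounded ℝ {v | coneInner g p v v < 1} := by
  have hr : 0 < coneRadius p := p.2.2
  have h1 := ((g.isVonNBounded p.1).image ((coneRadius p)⁻¹ • ContinuousLinearMap.inl ℝ E ℝ))
  have h2 := (NormedSpace.isVonNBounded_ball ℝ ℝ 1).image (ContinuousLinearMap.inr ℝ E ℝ)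
  refine (h1.add h2).subset ?_
  intro v hv
  have hv' := (coneInner_apply_coord g p v v).symm.trans_lt hv
  have h0 := riemannianMetric_self_nonneg g p.1 v.1
  refine Set.mem_add.2 ⟨(v.1, 0), ⟨coneRadius p • v.1, ?_, ?_⟩, (0, v.2), ⟨v.2, ?_, ?_⟩, ?_⟩
  · refine (riemannianMetric_smul_self g p.1 (coneRadius p) v.1).trans_lt ?_
    nlinarith [mul_self_nonneg v.2]
  · change (coneRadius p)⁻¹ • ((coneRadius p • v.1, 0) : E × ℝ) = (v.1, 0)
    rw [Prod.smul_mk, smul_zero]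
    congr 1
    exact inv_smul_smul₀ hr.ne' v.1
  · rw [mem_ball_zero_iff, Real.norm_eq_abs, abs_lt]
    constructor
     <;> nlinarith [mul_nonneg (sq_nonneg (coneRadius p)) h0]
  · simp
  · simp

set_option maxHeartbeats 1000000 in
theorem contMDiffAt_pullbackBilin {E F H N : Type*} [NormedAddCommGroup E] [NormedSpace ℝ E]
    [NormedAddCommGroup F] [NormedSpace ℝ F] [TopologicalSpace H] (J : ModelWithCorners ℝ F H)
    [TopologicalSpace N] [ChartedSpace H N] {p₀ : N} {G : N → E →L[ℝ] E →L[ℝ] ℝ} {A : N → F →L[ℝ] E}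
    (hG : ContMDiffAt J 𝓘(ℝ, E →L[ℝ] E →L[ℝ] ℝ) ∞ G p₀)
    (hA : ContMDiffAt J 𝓘(ℝ, F →L[ℝ] E) ∞ A p₀) :
    ContMDiffAt J 𝓘(ℝ, F →L[ℝ] F →L[ℝ] ℝ) ∞
      (fun p ↦ ((ContinuousLinearMap.compL ℝ F E ℝ).flip (A p)).comp ((G p).comp (A p))) p₀ :=
  (contMDiffAt_const.clm_apply hA).clm_comp (hG.clm_comp hA)

theorem contMDiffAt_conePullback {E F H N : Type*} [NormedAddCommGroup E] [NormedSpace ℝ E]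
    [NormedAddCommGroup F] [NormedSpace ℝ F] [TopologicalSpace H] (J : ModelWithCorners ℝ F H)
    [TopologicalSpace N] [ChartedSpace H N] {p₀ : N} {G : N → E →L[ℝ] E →L[ℝ] ℝ} {A : N → F →L[ℝ] E}
    {D : N → F →L[ℝ] ℝ} {r : N → ℝ} (hG : ContMDiffAt J 𝓘(ℝ, E →L[ℝ] E →L[ℝ] ℝ) ∞ G p₀)
    (hA : ContMDiffAt J 𝓘(ℝ, F →L[ℝ] E) ∞ A p₀) (hD : ContMDiffAt J 𝓘(ℝ, F →L[ℝ] ℝ) ∞ D p₀)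
    (hr : ContMDiffAt J 𝓘(ℝ, ℝ) ∞ r p₀) :
    ContMDiffAt J 𝓘(ℝ, F →L[ℝ] F →L[ℝ] ℝ) ∞
      (fun p ↦ ((ContinuousLinearMap.compL ℝ F ℝ ℝ).flip (D p)).comp
          ((ContinuousLinearMap.mul ℝ ℝ).comp (D p)) +
        r p ^ 2 • ((ContinuousLinearMap.compL ℝ F E ℝ).flip (A p)).comp ((G p).comp (A p))) p₀ :=
  (contMDiffAt_pullbackBilin J contMDiffAt_const hD).add
    ((hr.pow 2).smul (contMDiffAt_pullbackBilin J hG hA))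

theorem contMDiff_coneInner : ContMDiff (coneModel I) ((coneModel I).prod 𝓘(ℝ, (E × ℝ) →L[ℝ] (E × ℝ) →L[ℝ] ℝ)) ∞
    (fun p : Cone M ↦ Bundle.TotalSpace.mk' ((E × ℝ) →L[ℝ] (E × ℝ) →L[ℝ] ℝ) p (coneInner g p)) := by
  intro p₀
  rw [contMDiffAt_hom_bundle]
  refine ⟨contMDiffAt_id, ?_⟩
  have hG := ((contMDiffAt_hom_bundle _).1 ((g.contMDiff.comp (contMDiff_fst (I := I) (J := 𝓘(ℝ,ℝ)) (M := M) (N := PosReal))) p₀)).2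
  have hA := (contMDiff_fst (I := I) (J := 𝓘(ℝ,ℝ)) (M := M) (N := PosReal) (n := ∞) p₀).mfderiv_const (m := ∞) (by simp)
  have hD := (contMDiff_coneRadius (I := I) (M := M) p₀).mfderiv_const (m := ∞) (by simp)
  have hr := (contMDiff_coneRadius (I := I) (M := M) p₀)
  simp only [Function.comp_apply] at hG
  set G : Cone M → (E →L[ℝ] E →L[ℝ] ℝ) := _
  change ContMDiffAt _ _ _ G _ at hG
  set A : Cone M → (E × ℝ →L[ℝ] E) := _
  change ContMDiffAt _ _ _ A _ at hA
  set D : Cone M → (E × ℝ →L[ℝ] ℝ) := _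
  change ContMDiffAt _ _ _ D _ at hD
  refine (contMDiffAt_conePullback (coneModel I) hG hA hD hr).congr_of_eventuallyEq ?_
  have n1 : ∀ᶠ p in nhds p₀, p ∈ (chartAt (ModelProd H ℝ) p₀).source :=
    (chartAt (ModelProd H ℝ) p₀).open_source.mem_nhds (mem_chart_source _ _)
  have n2 : ∀ᶠ p in nhds p₀, p.1 ∈ (chartAt H p₀.1).source :=
    continuous_fst.continuousAt.eventually ((chartAt H p₀.1).open_source.mem_nhds (mem_chart_source _ _))
  filter_upwards [n1, n2] with p h1 h2
  refine ContinuousLinearMap.ext fun v ↦ ContinuousLinearMap.ext fun w ↦ ?_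
  have b1 : p ∈ (trivializationAt (E × ℝ) (TangentSpace (coneModel I)) p₀).baseSet := h1
  have b2 : p.1 ∈ (trivializationAt E (TangentSpace I) p₀.1).baseSet := h2
  have b3 : coneRadius p ∈ (trivializationAt ℝ (TangentSpace 𝓘(ℝ, ℝ)) (coneRadius p₀)).baseSet :=
    Set.mem_univ _
  refine (inCoordinates_apply_eq₂ b1 b1 (Set.mem_univ _)).trans ?_
  have eA : ∀ u, A p u = (trivializationAt E (TangentSpace I) p₀.1).continuousLinearMapAt ℝ p.1
    (coneProjDeriv I p ((trivializationAt (E × ℝ) (TangentSpace (coneModel I)) p₀).symmL ℝ p u)) := by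
    intro u
    simp only [A, inTangentCoordinates, ContinuousLinearMap.inCoordinates]
    rfl
  have eD : ∀ u, D p u = (coneDr I p ((trivializationAt (E × ℝ) (TangentSpace (coneModel I)) p₀).symmL ℝ p u)) := by
    intro u
    have : D p u = (trivializationAt ℝ (TangentSpace 𝓘(ℝ, ℝ)) (coneRadius p₀)).continuousLinearMapAt ℝ (coneRadius p)
      (coneDr I p ((trivializationAt (E × ℝ) (TangentSpace (coneModel I)) p₀).symmL ℝ p u)) := rfl
    rw [this, TangentBundle.continuousLinearMapAt_model_space]
    rfl
  have eG : ∀ a b, G p a b = g.inner p.1 ((trivializationAt E (TangentSpace I) p₀.1).symmL ℝ p.1 a)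
    ((trivializationAt E (TangentSpace I) p₀.1).symmL ℝ p.1 b) := fun a b ↦
      by
        rw [Bundle.Trivialization.symmL_apply _ b2, Bundle.Trivialization.symmL_apply _ b2]
        exact (inCoordinates_apply_eq₂ b2 b2 (Set.mem_univ _)).trans (by simp)
  have sm : ∀ a, (trivializationAt E (TangentSpace I) p₀.1).symmL ℝ p.1
    ((trivializationAt E (TangentSpace I) p₀.1).continuousLinearMapAt ℝ p.1 a) = a := fun a ↦
    (trivializationAt E (TangentSpace I) p₀.1).symmL_continuousLinearMapAt b2 a
  have eR : (((ContinuousLinearMap.compL ℝ (E × ℝ) ℝ ℝ).flip (D p)).comp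
          ((ContinuousLinearMap.mul ℝ ℝ).comp (D p)) + coneRadius p ^ 2 •
      ((ContinuousLinearMap.compL ℝ (E × ℝ) E ℝ).flip (A p)).comp ((G p).comp (A p))) v w =
      D p v * D p w + coneRadius p ^ 2 * G p (A p v) (A p w) := by
    simp
  refine Eq.trans ?_ eR.symm
  rw [eG, eA, eA, sm, sm, eD, eD]
  rw [Bundle.Trivialization.symmL_apply _ b1, Bundle.Trivialization.symmL_apply _ b1]
  refine Eq.trans ?_ (coneInner_apply g p _ _)
  simp

/-- The cone metric `dr² + r² g`, a smooth Riemannian metric on `C(M) = M × ℝ⁺`. -/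
def coneMetric : Bundle.ContMDiffRiemannianMetric (coneModel I) ∞ (E × ℝ)
    (fun p : Cone M ↦ TangentSpace (coneModel I) p) where
  inner := coneInner g
  symm p v w := by
    rw [coneInner_apply, coneInner_apply, g.symm, mul_comm (coneDr I p v)]
  pos p v hv := by
    have hr : 0 < coneRadius p := p.2.2
    have h := coneInner_apply_coord g p v v
    have h0 := riemannianMetric_self_nonneg g p.1 v.1
    refine lt_of_lt_of_eq ?_ h.symm
    by_cases h1 : (v.1 : TangentSpace I p.1) = 0
    · have h2 : v.2 ≠ 0 := fun h2 ↦ hv (Prod.ext h1 h2)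
      have h3 : 0 < v.2 * v.2 := mul_self_pos.2 h2
      have h4 := mul_nonneg (sq_nonneg (coneRadius p)) h0
      linarith
    · have h3 := mul_pos (pow_pos hr 2) (g.pos p.1 v.1 h1)
      have h4 := mul_self_nonneg v.2
      linarith
  isVonNBounded := coneInner_isVonNBounded g
  contMDiff := contMDiff_coneInner g

end ConeMetric

section TensorCalculus

variable {E : Type*} [NormedAddCommGroup E] [NormedSpace ℝ E]
  {H : Type*} [TopologicalSpace H] (I : ModelWithCorners ℝ E H)
  (M : Type*) [TopologicalSpace M] [ChartedSpace H M] [IsManifold I 1 M]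

/-- Smooth vector fields on `M`. -/
abbrev SmoothVectorField : Type _ :=
  Cₛ^∞⟮I; E, fun x : M ↦ TangentSpace I x⟯

/-- Smooth 1-forms on `M`. -/
abbrev SmoothOneForm : Type _ :=
  Cₛ^∞⟮I; E →L[ℝ] ℝ, fun x : M ↦ TangentSpace I x →L[ℝ] ℝ⟯

/-- Smooth sections of `End TM`, i.e. smooth `(1,1)` tensor fields on `M`. -/
abbrev SmoothEndField : Type _ :=
  Cₛ^∞⟮I; E →L[ℝ] E, fun x : M ↦ TangentSpace I x →L[ℝ] TangentSpace I x⟯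

variable {I M}

/-- The derivative `X f` of a function along a vector field. -/
def dirDeriv (X : Π x : M, TangentSpace I x) (f : M → ℝ) (x : M) : ℝ :=
  mfderiv I 𝓘(ℝ, ℝ) f x (X x)

/-- The vector field `Φ X`. -/
def SmoothEndField.app (Φ : SmoothEndField I M) (X : Π x : M, TangentSpace I x) :
    Π x : M, TangentSpace I x :=
  fun x ↦ Φ x (X x)

/-- The exterior derivative of a 1-form, evaluated on two vector fields:
`dη(X, Y) = X η(Y) - Y η(X) - η([X, Y])` (no factor `1/2`). -/
def extDerivOne (η : SmoothOneForm I M) (X Y : Π x : M, TangentSpace I x) (x : M) : ℝ :=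
  dirDeriv X (fun y ↦ η y (Y y)) x - dirDeriv Y (fun y ↦ η y (X y)) x
    - η x (VectorField.mlieBracket I X Y x)

/-- The exterior derivative of a 2-form, evaluated on three vector fields:
`dΩ(X, Y, Z)` is the cyclic sum of `X Ω(Y, Z) - Ω([X, Y], Z)`. -/
def extDerivTwo (Ω : Π x : M, TangentSpace I x → TangentSpace I x → ℝ)
    (X Y Z : Π x : M, TangentSpace I x) (x : M) : ℝ :=
  dirDeriv X (fun y ↦ Ω y (Y y) (Z y)) x + dirDeriv Y (fun y ↦ Ω y (Z y) (X y)) x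
    + dirDeriv Z (fun y ↦ Ω y (X y) (Y y)) x
    - Ω x (VectorField.mlieBracket I X Y x) (Z x)
    - Ω x (VectorField.mlieBracket I Y Z x) (X x)
    - Ω x (VectorField.mlieBracket I Z X x) (Y x)

/-- The Nijenhuis tensor
`N_Φ(X, Y) = [ΦX, ΦY] + Φ² [X, Y] - Φ [X, ΦY] - Φ [ΦX, Y]`. -/
def nijenhuis (Φ : SmoothEndField I M) (X Y : Π x : M, TangentSpace I x) (x : M) :
    TangentSpace I x :=
  VectorField.mlieBracket I (Φ.app X) (Φ.app Y) x
    + Φ x (Φ x (VectorField.mlieBracket I X Y x))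
    - Φ x (VectorField.mlieBracket I X (Φ.app Y) x)
    - Φ x (VectorField.mlieBracket I (Φ.app X) Y x)

/-- `η` is a contact form: it vanishes nowhere, and `dη` is nondegenerate on `ker η` at each point.
(In dimension `2n + 1` this says that `η ∧ (dη)ⁿ` vanishes nowhere, and it forces the dimension
to be odd.) -/
def IsContactForm (η : SmoothOneForm I M) : Prop :=
  ∀ x : M, η x ≠ 0 ∧
    ∀ X : SmoothVectorField I M, η x (X x) = 0 →
      (∀ Y : SmoothVectorField I M, η x (Y x) = 0 → extDerivOne η X Y x = 0) → X x = 0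

/-- The totally antisymmetric symbol on three indices, with `ε 0 1 2 = 1`. -/
def epsilonThree (a b c : Fin 3) : ℝ :=
  (((b : ℕ) : ℝ) - ((a : ℕ) : ℝ)) * (((c : ℕ) : ℝ) - ((a : ℕ) : ℝ))
    * (((c : ℕ) : ℝ) - ((b : ℕ) : ℝ)) / 2

end TensorCalculus

section Structures

variable {E : Type*} [NormedAddCommGroup E] [NormedSpace ℝ E]
  {H : Type*} [TopologicalSpace H] {I : ModelWithCorners ℝ E H}
  {M : Type*} [TopologicalSpace M] [ChartedSpace H M] [IsManifold I 1 M]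

/-- A contact metric structure `(η, ξ, Φ)` compatible with the Riemannian metric `g`.
The normalization is the one for which the unit sphere carries such a structure: with the `1/2`
convention for exterior derivatives of 1-forms, `associated` reads `dη(X, ΦY) = g(X, Y) - η(X) η(Y)`.
-/
structure ContactMetricStructure
    (g : Bundle.ContMDiffRiemannianMetric I ∞ E (fun x : M ↦ TangentSpace I x)) where
  /-- the contact form -/
  eta : SmoothOneForm I M
  /-- the Reeb vector field -/
  xi : SmoothVectorField I M
  /-- the structure tensor -/
  Phi : SmoothEndField I M
  isContactForm : IsContactForm eta
  eta_xi : ∀ x, eta x (xi x) = 1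
  reeb : ∀ (X : SmoothVectorField I M) (x : M), extDerivOne eta xi X x = 0
  Phi_sq : ∀ (x : M) (v : TangentSpace I x), Phi x (Phi x v) = -v + eta x v • xi x
  compatible : ∀ (x : M) (v w : TangentSpace I x),
    g.inner x (Phi x v) (Phi x w) = g.inner x v w - eta x v * eta x w
  associated : ∀ (X Y : SmoothVectorField I M) (x : M),
    extDerivOne eta X (Phi.app Y) x = 2 * (g.inner x (X x) (Y x) - eta x (X x) * eta x (Y x))

/-- A contact metric structure is normal (i.e. Sasakian) if `N_Φ = - dη ⊗ ξ`, where
`dη(X, Y) = X η(Y) - Y η(X) - η([X, Y])`. -/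
def ContactMetricStructure.IsNormal
    {g : Bundle.ContMDiffRiemannianMetric I ∞ E (fun x : M ↦ TangentSpace I x)}
    (S : ContactMetricStructure g) : Prop :=
  ∀ (X Y : SmoothVectorField I M) (x : M),
    nijenhuis S.Phi X Y x = -(extDerivOne S.eta X Y x • S.xi x)

/-- A metric contact 3-structure compatible with `g`: three contact metric structures with the same
metric `g` such that `Φᵃ ∘ Φᵇ - ξᵃ ⊗ ηᵇ = - ∑ c, εᵃᵇᶜ Φᶜ - δᵃᵇ id`. -/
structure ContactThreeStructure
    (g : Bundle.ContMDiffRiemannianMetric I ∞ E (fun x : M ↦ TangentSpace I x)) where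
  /-- the three contact metric structures -/
  str : Fin 3 → ContactMetricStructure g
  relations : ∀ (a b : Fin 3) (x : M) (v : TangentSpace I x),
    (str a).Phi x ((str b).Phi x v) - (str b).eta x v • (str a).xi x
      = -(∑ c, epsilonThree a b c • (str c).Phi x v) - (if a = b then v else 0)

/-- `(M, g)` has a compatible metric contact 3-structure. -/
def HasContactThreeStructure
    (g : Bundle.ContMDiffRiemannianMetric I ∞ E (fun x : M ↦ TangentSpace I x)) : Prop :=
  Nonempty (ContactThreeStructure g)

/-- `(M, g)` is 3-Sasakian: it has a compatible metric contact 3-structure whose three contact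
metric structures are normal. -/
def IsThreeSasakian
    (g : Bundle.ContMDiffRiemannianMetric I ∞ E (fun x : M ↦ TangentSpace I x)) : Prop :=
  ∃ S : ContactThreeStructure g, ∀ a, (S.str a).IsNormal

/-- An almost hyperkähler structure on `(M, g)`: three almost complex structures, orthogonal for
`g`, satisfying the quaternion relations `Jᵃ ∘ Jᵇ = ∑ c, εᵃᵇᶜ Jᶜ - δᵃᵇ id`, whose fundamental
2-forms `ωᵃ(X, Y) = g(X, Jᵃ Y)` are all closed. -/
structure AlmostHyperkahlerStructure
    (g : Bundle.ContMDiffRiemannianMetric I ∞ E (fun x : M ↦ TangentSpace I x)) where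
  /-- the three almost complex structures -/
  J : Fin 3 → SmoothEndField I M
  quaternion : ∀ (a b : Fin 3) (x : M) (v : TangentSpace I x),
    J a x (J b x v) = (∑ c, epsilonThree a b c • J c x v) - (if a = b then v else 0)
  orthogonal : ∀ (a : Fin 3) (x : M) (v w : TangentSpace I x),
    g.inner x (J a x v) (J a x w) = g.inner x v w
  closed : ∀ (a : Fin 3) (X Y Z : SmoothVectorField I M) (x : M),
    extDerivTwo (fun y v w ↦ g.inner y v (J a y w)) X Y Z x = 0

/-- `(M, g)` is almost hyperkähler. -/
def IsAlmostHyperkahler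
    (g : Bundle.ContMDiffRiemannianMetric I ∞ E (fun x : M ↦ TangentSpace I x)) : Prop :=
  Nonempty (AlmostHyperkahlerStructure g)

/-- `(M, g)` is hyperkähler: it has an almost hyperkähler structure whose three almost complex
structures are integrable (their Nijenhuis tensors vanish). -/
def IsHyperkahler
    (g : Bundle.ContMDiffRiemannianMetric I ∞ E (fun x : M ↦ TangentSpace I x)) : Prop :=
  ∃ S : AlmostHyperkahlerStructure g, ∀ (a : Fin 3) (X Y : SmoothVectorField I M) (x : M),
    nijenhuis (S.J a) X Y x = 0

end Structures

end

noncomputable section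

set_option linter.unusedSectionVars false

/-! ### Directional derivatives, Lie brackets and smooth extensions. -/

section Calculus

variable {E : Type*} [NormedAddCommGroup E] [NormedSpace ℝ E]
  {H : Type*} [TopologicalSpace H] {I : ModelWithCorners ℝ E H}
  {M : Type*} [TopologicalSpace M] [ChartedSpace H M]

/-! All four properties turn out to be equivalent: a contact 3-structure makes the cone almost
hyperkähler, and an almost hyperkähler cone is automatically hyperkähler and its base automatically
3-Sasakian. Write `V = r ∂/∂r` for the Euler field and `h` for the cone metric.

From base to cone, put `J X = -Φ X + η(X) V` for `X` tangent to `M`, and `J V = -ξ`. Orthogonality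
and the quaternion relations are pointwise algebra. The fundamental form is `ω = ½ d(r² η)`
(`coneComplex_fundamental`), so it is closed because `d² = 0`.

From cone to base, Hitchin's lemma (`AlmostHyperkahlerStructure.nijenhuis_eq_zero`) first makes
every `Jᵃ` integrable: with respect to one of the three structures, the other two fundamental forms
combine into a closed form of type (2,0).

The main point is that `V` preserves each `J` (`coneEuler_bracket_J`). The cone metric is
homothetic, `L_V h = 2h`, so Cartan's formula and `dω = 0` give `d(V ⌟ ω) = 2ω + h(·, (L_V J) ·)`.
The left side is `J`-invariant, since `V ⌟ ω` is `V♭ ∘ J` with `V♭ = r dr` closed and `J`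
integrable; so is `2ω`. The last term is `J`-anti-invariant because `L_V J` anticommutes with `J`.
Hence `L_V J = 0` and `d(V ⌟ ω) = 2ω`.

Consequently `J` is determined by its values on the slice `r = 1`. There the tangential and radial
parts of `J` give `Φ`, `ξ`, `η`, with `η` the restriction of `V ⌟ ω`, so that `dη` is the
restriction of `2ω`. The quaternion relations become those of a contact 3-structure, and the
`M`-component of the vanishing Nijenhuis tensor of `J` is normality. -/

theorem dirDeriv_add_fun {X : Π x : M, TangentSpace I x} {f g : M → ℝ} {x : M}
    (hf : MDiffAt f x) (hg : MDiffAt g x) :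
    dirDeriv X (fun y ↦ f y + g y) x = dirDeriv X f x + dirDeriv X g x := by
  have := (hf.hasMFDerivAt.add hg.hasMFDerivAt).mfderiv
  rw [dirDeriv, show (fun y ↦ f y + g y) = f + g from rfl, this]
  rfl

theorem dirDeriv_neg_fun {X : Π x : M, TangentSpace I x} {f : M → ℝ} {x : M} :
    dirDeriv X (fun y ↦ - f y) x = - dirDeriv X f x := by
  rw [dirDeriv, show (fun y ↦ - f y) = - f from rfl, mfderiv_neg]
  rfl

theorem dirDeriv_sub_fun {X : Π x : M, TangentSpace I x} {f g : M → ℝ} {x : M}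
    (hf : MDiffAt f x) (hg : MDiffAt g x) :
    dirDeriv X (fun y ↦ f y - g y) x = dirDeriv X f x - dirDeriv X g x := by
  have := (hf.hasMFDerivAt.sub hg.hasMFDerivAt).mfderiv
  rw [dirDeriv, show (fun y ↦ f y - g y) = f - g from rfl, this]
  rfl

theorem dirDeriv_mul_fun {X : Π x : M, TangentSpace I x} {f g : M → ℝ} {x : M}
    (hf : MDiffAt f x) (hg : MDiffAt g x) :
    dirDeriv X (fun y ↦ f y * g y) x = f x * dirDeriv X g x + g x * dirDeriv X f x := by
  have := (hf.hasMFDerivAt.mul hg.hasMFDerivAt).mfderiv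
  rw [dirDeriv, show (fun y ↦ f y * g y) = f * g from rfl, this]
  rfl

theorem dirDeriv_const_mul {X : Π x : M, TangentSpace I x} {f : M → ℝ} {x : M} (c : ℝ)
    (hf : MDiffAt f x) :
    dirDeriv X (fun y ↦ c * f y) x = c * dirDeriv X f x := by
  have := (hf.hasMFDerivAt.const_smul c).mfderiv
  rw [dirDeriv, show (fun y ↦ c * f y) = c • f from rfl, this]
  rfl

theorem dirDeriv_const (X : Π x : M, TangentSpace I x) (c : ℝ) (x : M) :
    dirDeriv X (fun _ : M ↦ c) x = 0 := by
  rw [dirDeriv, mfderiv_const]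
  rfl

theorem dirDeriv_add (X Y : Π x : M, TangentSpace I x) (f : M → ℝ) (x : M) :
    dirDeriv (X + Y) f x = dirDeriv X f x + dirDeriv Y f x :=
  map_add (mvfderiv I f x) _ _

theorem dirDeriv_smul (h : M → ℝ) (X : Π x : M, TangentSpace I x) (f : M → ℝ) (x : M) :
    dirDeriv (h • X) f x = h x * dirDeriv X f x :=
  map_smul (mvfderiv I f x) _ _

variable [IsManifold I ∞ M]

theorem contMDiff_dirDeriv {X : Π x : M, TangentSpace I x} (hX : CMDiff ∞ (T% X)) {f : M → ℝ}
    (hf : CMDiff ∞ f) : CMDiff ∞ (dirDeriv X f) := by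
  have h1 := (hf.contMDiff_tangentMap (m := ∞) (by simp)).comp hX
  exact (contMDiff_snd_tangentBundle_modelSpace ℝ 𝓘(ℝ, ℝ)).comp h1

theorem isManifold_minSmoothness_three : IsManifold I (minSmoothness ℝ 3) M :=
  IsManifold.of_le (n := ∞) (by
    simpa using (WithTop.coe_le_coe.2 le_top : ((3 : ℕ∞) : ℕ∞ω) ≤ ∞))

theorem isManifold_top_add_one : IsManifold I (((⊤ : ℕ∞) : ℕ∞ω) + 1) M :=
  IsManifold.of_le (n := ∞) (by simp)

attribute [local instance] isManifold_minSmoothness_three isManifold_top_add_one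

variable [FiniteDimensional ℝ E] [CompleteSpace E] [T2Space M]

theorem contMDiff_mlieBracket {X Y : Π x : M, TangentSpace I x} (hX : CMDiff ∞ (T% X))
    (hY : CMDiff ∞ (T% Y)) : CMDiff ∞ (T% (VectorField.mlieBracket I X Y)) :=
  ContDiff.mlieBracket_vectorField (m := ⊤) (n := ⊤) hX hY (by simp)

theorem mlieBracket_smul_right_dirDeriv {X Y : Π x : M, TangentSpace I x} {f : M → ℝ} {x : M}
    (hf : MDiffAt f x) (hY : MDiffAt (T% Y) x) :
    VectorField.mlieBracket I X (f • Y) x =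
      dirDeriv X f x • Y x + f x • VectorField.mlieBracket I X Y x :=
  VectorField.mlieBracket_smul_right hf hY

/-- A bump function cuts off the local extension of `v`. Agreement on a neighbourhood, rather than
only at `x`, is what the smoothness criterion `contMDiff_hom_of_forall_apply` needs. -/
theorem exists_smoothVectorField_eventuallyEq_extend (x : M) (v : TangentSpace I x) :
    ∃ X : SmoothVectorField I M, ∀ᶠ y in nhds x, X y = FiberBundle.extend E v y := by
  obtain ⟨s, hs, hsm⟩ := FiberBundle.exists_contMDiffOn_extend (k := ∞) I E v
  obtain ⟨u, hus, hu, hxu⟩ := mem_nhds_iff.1 hs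
  obtain ⟨b, -, hb⟩ := (SmoothBumpFunction.nhds_basis_tsupport (I := I) x).mem_iff.1
    (hu.mem_nhds hxu)
  refine ⟨⟨fun y ↦ b y • FiberBundle.extend E v y, ?_⟩, ?_⟩
  · exact (ContMDiffOn.smul_section_of_tsupport (u := u)
      b.contMDiff.contMDiffOn hu hb (hsm.mono hus))
  · filter_upwards [b.eventuallyEq_one] with y hy
    change b y • FiberBundle.extend E v y = _
    rw [hy, Pi.one_apply, one_smul]

theorem exists_smoothVectorField_apply_eq (x : M) (v : TangentSpace I x) :
    ∃ X : SmoothVectorField I M, X x = v := by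
  obtain ⟨X, hX⟩ := exists_smoothVectorField_eventuallyEq_extend x v
  exact ⟨X, hX.self_of_nhds.trans (FiberBundle.extend_apply_self _ _)⟩

/-- Follows from the Jacobi identity alone: expanding it for `X, Y, f W` and subtracting `f` times
the identity for `X, Y, W` leaves `(X(Yf) - Y(Xf) - [X, Y]f) W = 0`, and `W` is chosen nonzero at
`x`. In dimension zero no such `W` exists and both sides vanish. -/
theorem dirDeriv_mlieBracket {X Y : Π x : M, TangentSpace I x} (hX : CMDiff ∞ (T% X))
    (hY : CMDiff ∞ (T% Y)) {f : M → ℝ} {x : M} (hf : CMDiff ∞ f) :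
    dirDeriv (VectorField.mlieBracket I X Y) f x =
      dirDeriv X (dirDeriv Y f) x - dirDeriv Y (dirDeriv X f) x := by
  rcases subsingleton_or_nontrivial E with hE | hE
  · have h (Z : Π x : M, TangentSpace I x) (g : M → ℝ) : dirDeriv Z g x = 0 := by
      have : Z x = 0 := Subsingleton.elim (α := E) _ _
      rw [dirDeriv, this]
      exact map_zero (mvfderiv I g x)
    rw [h, h, h, sub_zero]
  · obtain ⟨w, hw⟩ := exists_ne (0 : E)
    obtain ⟨W, hWx⟩ := exists_smoothVectorField_apply_eq (I := I) x (w : TangentSpace I x)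
    have hW : CMDiff ∞ (T% (⇑W : Π x : M, TangentSpace I x)) := W.contMDiff
    have mdf (g : M → ℝ) (hg : CMDiff ∞ g) : MDiffAt g x := (hg x).mdifferentiableAt (by simp)
    have mds {Z : Π x : M, TangentSpace I x} (hZ : CMDiffAt ∞ (T% Z) x) : MDiffAt (T% Z) x :=
      hZ.mdifferentiableAt (by simp)
    have le2 : minSmoothness ℝ 2 ≤ ∞ := by
      simpa using (WithTop.coe_le_coe.2 le_top : ((2 : ℕ∞) : ℕ∞ω) ≤ ∞)
    have expand {X Y : Π x : M, TangentSpace I x} (hX : CMDiff ∞ (T% X)) (hY : CMDiff ∞ (T% Y)) :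
        VectorField.mlieBracket I X (VectorField.mlieBracket I Y (f • ⇑W)) x =
          dirDeriv X (dirDeriv Y f) x • W x + dirDeriv Y f x • VectorField.mlieBracket I X W x +
          (dirDeriv X f x • VectorField.mlieBracket I Y W x +
            f x • VectorField.mlieBracket I X (VectorField.mlieBracket I Y W) x) := by
      have e : VectorField.mlieBracket I Y (f • ⇑W) =
          dirDeriv Y f • ⇑W + f • VectorField.mlieBracket I Y W :=
        funext fun y ↦ mlieBracket_smul_right_dirDeriv ((hf y).mdifferentiableAt (by simp))
          ((hW y).mdifferentiableAt (by simp))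
      have hYf := contMDiff_dirDeriv hY hf
      have hYW := contMDiff_mlieBracket hY hW x
      rw [e,
        VectorField.mlieBracket_add_right (mds ((hYf x).smul_section (hW x)))
          (mds ((hf x).smul_section hYW)),
        mlieBracket_smul_right_dirDeriv (mdf _ hYf) (mds (hW x)),
        mlieBracket_smul_right_dirDeriv (mdf _ hf) (mds hYW)]
    have J1 := VectorField.leibniz_identity_mlieBracket_apply (I := I) (U := X) (V := Y)
      (W := f • ⇑W) (x := x) ((hX x).of_le le2) ((hY x).of_le le2)
      (((hf x).smul_section (hW x)).of_le le2)
    have J2 := VectorField.leibniz_identity_mlieBracket_apply (I := I) (U := X) (V := Y)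
      (W := ⇑W) (x := x) ((hX x).of_le le2) ((hY x).of_le le2) ((hW x).of_le le2)
    rw [expand hX hY, expand hY hX, mlieBracket_smul_right_dirDeriv (mdf _ hf) (mds (hW x)), J2] at J1
    have h0 : (dirDeriv X (dirDeriv Y f) x - dirDeriv Y (dirDeriv X f) x -
        dirDeriv (VectorField.mlieBracket I X Y) f x) • W x = 0 := by
      rw [← sub_eq_zero.2 J1]
      module
    have := (smul_eq_zero.1 h0).resolve_right (by rw [hWx]; exact hw)
    linarith

/-- Linear functionals composed with a chart and cut off by a bump function already separate tangent
vectors. Vector fields, brackets in particular, can therefore be identified by their action on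
functions. -/
theorem eq_zero_of_forall_mfderiv_eq_zero {x : M}
    {v : TangentSpace I x}
    (h : ∀ f : M → ℝ, CMDiff ∞ f → mvfderiv I f x v = 0) : v = 0 := by
  have inv := isInvertible_mfderiv_extChartAt (I := I) (mem_extChartAt_source (I := I) x)
  obtain ⟨e, he⟩ := inv
  have key : mfderiv I 𝓘(ℝ, E) (extChartAt I x) x v = 0 := by
    by_contra hne
    obtain ⟨ℓ, hℓ⟩ : ∃ ℓ : E →L[ℝ] ℝ, ℓ (mvfderiv I (extChartAt I x) x v) ≠ 0 :=
      SeparatingDual.exists_ne_zero (R := ℝ) (V := E) hne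
    obtain ⟨b, -, -⟩ := (SmoothBumpFunction.nhds_basis_tsupport (I := I) x).mem_iff.1
      Filter.univ_mem
    have hs : CMDiff ∞ (fun y ↦ b y • ℓ (extChartAt I x y)) := by
      refine b.contMDiff_smul ?_
      exact ℓ.contMDiff.comp_contMDiffOn contMDiffOn_extChartAt
    have h1 := h _ hs
    have e1 : (fun y ↦ b y • ℓ (extChartAt I x y)) =ᶠ[nhds x] ℓ ∘ extChartAt I x := by
      filter_upwards [b.eventuallyEq_one] with y hy
      simp [hy]
    have h2 := ((ℓ.hasMFDerivAt (x := extChartAt I x x)).comp x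
      (mdifferentiableAt_extChartAt (I := I) (mem_chart_source H x)).hasMFDerivAt).mfderiv
    rw [mvfderiv, e1.mfderiv_eq] at h1
    erw [h2] at h1
    exact hℓ h1
  rw [← he] at key
  exact e.injective (key.trans (map_zero e).symm)

end Calculus

attribute [local instance] isManifold_minSmoothness_three isManifold_top_add_one

/-! ### Smooth fields, tensoriality of `dη`, and `d² = 0`. -/

section Fields

variable {E : Type*} [NormedAddCommGroup E] [NormedSpace ℝ E]
  {H : Type*} [TopologicalSpace H] {I : ModelWithCorners ℝ E H}
  {M : Type*} [TopologicalSpace M] [ChartedSpace H M] [IsManifold I ∞ M]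

theorem ContMDiff.mdifferentiableAt_real {f : M → ℝ} (hf : CMDiff ∞ f) (x : M) : MDiffAt f x :=
  (hf x).mdifferentiableAt (by simp)

namespace SmoothVectorField

/-- The smooth vector field `f X`. -/
def fsmul (f : M → ℝ) (hf : CMDiff ∞ f) (X : SmoothVectorField I M) : SmoothVectorField I M :=
  ⟨f • ⇑X, hf.smul_section X.contMDiff⟩

theorem coe_fsmul (f : M → ℝ) (hf : CMDiff ∞ f) (X : SmoothVectorField I M) :
    ⇑(fsmul f hf X) = f • ⇑X := rfl

end SmoothVectorField

theorem SmoothOneForm.contMDiff_apply (η : SmoothOneForm I M) {X : Π x : M, TangentSpace I x}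
    (hX : CMDiff ∞ (T% X)) : CMDiff ∞ (fun x ↦ η x (X x)) := by
  have h := ContMDiff.clm_bundle_apply (E₂ := Bundle.Trivial M ℝ) (F₂ := ℝ) η.contMDiff hX
  exact fun x ↦ ((Bundle.contMDiffAt_section _).1 (h x))

/-- The value `Φ X` of an endomorphism field on a smooth vector field, as a smooth vector field. -/
def SmoothEndField.appField (Φ : SmoothEndField I M) (X : SmoothVectorField I M) :
    SmoothVectorField I M :=
  ⟨Φ.app X, ContMDiff.clm_bundle_apply Φ.contMDiff X.contMDiff⟩

theorem SmoothEndField.coe_appField (Φ : SmoothEndField I M) (X : SmoothVectorField I M) :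
    ⇑(Φ.appField X) = Φ.app X := rfl

theorem SmoothEndField.appField_apply (Φ : SmoothEndField I M) (X : SmoothVectorField I M) (x : M) :
    Φ.appField X x = Φ x (X x) := rfl

theorem contMDiff_metric_apply
    (g : Bundle.ContMDiffRiemannianMetric I ∞ E (fun x : M ↦ TangentSpace I x))
    (X Y : SmoothVectorField I M) : CMDiff ∞ (fun x ↦ g.inner x (X x) (Y x)) := by
  have h := ContMDiff.clm_bundle_apply₂ (E₃ := Bundle.Trivial M ℝ) (F₃ := ℝ)
    g.contMDiff X.contMDiff Y.contMDiff
  exact fun x ↦ ((Bundle.contMDiffAt_section _).1 (h x))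

variable [FiniteDimensional ℝ E] [CompleteSpace E] [T2Space M]

/-- The Lie bracket of two smooth vector fields, as a smooth vector field. -/
def SmoothVectorField.bracket (X Y : SmoothVectorField I M) : SmoothVectorField I M :=
  ⟨VectorField.mlieBracket I X Y, contMDiff_mlieBracket X.contMDiff Y.contMDiff⟩

theorem SmoothVectorField.coe_bracket (X Y : SmoothVectorField I M) :
    ⇑(X.bracket Y) = VectorField.mlieBracket I X Y := rfl

theorem SmoothVectorField.dirDeriv_bracket (X Y : SmoothVectorField I M) {f : M → ℝ}
    (hf : CMDiff ∞ f) (x : M) :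
    dirDeriv (X.bracket Y) f x = dirDeriv X (dirDeriv Y f) x - dirDeriv Y (dirDeriv X f) x :=
  dirDeriv_mlieBracket X.contMDiff Y.contMDiff hf

theorem extDerivOne_swap (η : SmoothOneForm I M) (X Y : Π x : M, TangentSpace I x) (x : M) :
    extDerivOne η X Y x = - extDerivOne η Y X x := by
  rw [extDerivOne, extDerivOne, VectorField.mlieBracket_swap_apply, map_neg]
  ring

theorem SmoothOneForm.mdifferentiableAt_apply (η : SmoothOneForm I M)
    {X : Π x : M, TangentSpace I x} {x : M}
    (hX : MDiffAt (T% X) x) : MDiffAt (fun x ↦ η x (X x)) x := by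
  have h := MDifferentiableAt.clm_bundle_apply (E₂ := Bundle.Trivial M ℝ) (F₂ := ℝ)
    (η.contMDiff.mdifferentiableAt (by simp)) hX
  exact ((mdifferentiableAt_section _ _).1 h)

theorem tensorialAt_extDerivOne_right (η : SmoothOneForm I M) (X : Π x : M, TangentSpace I x)
    (x : M) :
    TensorialAt I E (fun Y : Π x : M, TangentSpace I x ↦ extDerivOne η X Y x) x where
  smul {f Y} hf hY := by
    have e1 : (fun y ↦ η y ((f • Y) y)) = fun y ↦ f y * η y (Y y) :=
      funext fun y ↦ map_smul (η y) _ _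
    rw [extDerivOne, extDerivOne, e1, dirDeriv_mul_fun hf (η.mdifferentiableAt_apply hY),
      dirDeriv_smul, mlieBracket_smul_right_dirDeriv hf hY, map_add, map_smul, map_smul]
    simp only [smul_eq_mul]
    ring
  add {Y Z} hY hZ := by
    have e1 : (fun y ↦ η y ((Y + Z) y)) = fun y ↦ η y (Y y) + η y (Z y) :=
      funext fun y ↦ map_add (η y) _ _
    rw [extDerivOne, extDerivOne, extDerivOne, e1, dirDeriv_add_fun (η.mdifferentiableAt_apply hY)
      (η.mdifferentiableAt_apply hZ), dirDeriv_add, VectorField.mlieBracket_add_right hY hZ, map_add]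
    ring

theorem tensorialAt_extDerivOne_left (η : SmoothOneForm I M) (X : Π x : M, TangentSpace I x)
    (x : M) :
    TensorialAt I E (fun Y : Π x : M, TangentSpace I x ↦ extDerivOne η Y X x) x where
  smul {f Y} hf hY := by
    rw [extDerivOne_swap, (tensorialAt_extDerivOne_right η X x).smul hf hY, extDerivOne_swap η Y]
    simp
  add {Y Z} hY hZ := by
    rw [extDerivOne_swap, (tensorialAt_extDerivOne_right η X x).add hY hZ, extDerivOne_swap η Y,
      extDerivOne_swap η Z]
    ring

theorem SmoothVectorField.mdiffAt (X : SmoothVectorField I M) (x : M) :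
    MDiffAt (T% (⇑X : Π x : M, TangentSpace I x)) x :=
  (X.contMDiff x).mdifferentiableAt (by simp)

theorem extDerivOne_congr (η : SmoothOneForm I M) {X X' Y Y' : SmoothVectorField I M} {x : M}
    (hX : X x = X' x) (hY : Y x = Y' x) : extDerivOne η X Y x = extDerivOne η X' Y' x :=
  TensorialAt.pointwise₂ (fun _ _ ↦ tensorialAt_extDerivOne_left η _ x)
    (fun _ _ ↦ tensorialAt_extDerivOne_right η _ x)
    (X.mdiffAt x) (X'.mdiffAt x) (Y.mdiffAt x) (Y'.mdiffAt x) hX hY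

theorem extDerivOne_add_right (η : SmoothOneForm I M) (X Y Z : SmoothVectorField I M) (x : M) :
    extDerivOne η X (⇑Y + ⇑Z) x = extDerivOne η X Y x + extDerivOne η X Z x :=
  (tensorialAt_extDerivOne_right η X x).add (Y.mdiffAt x) (Z.mdiffAt x)

theorem extDerivOne_smul_right (η : SmoothOneForm I M) (X Y : SmoothVectorField I M) {f : M → ℝ}
    {x : M} (hf : MDiffAt f x) :
    extDerivOne η X (f • ⇑Y) x = f x * extDerivOne η X Y x :=
  (tensorialAt_extDerivOne_right η X x).smul hf (Y.mdiffAt x)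

/-- `d² = 0` on 1-forms, for a 2-form given pointwise by `Ω`. -/
theorem extDerivTwo_eq_zero_of_extDerivOne (β : SmoothOneForm I M) (c : ℝ)
    {Ω : Π x : M, TangentSpace I x → TangentSpace I x → ℝ}
    (h : ∀ (X Y : SmoothVectorField I M) (x : M), Ω x (X x) (Y x) = c * extDerivOne β X Y x)
    (X Y Z : SmoothVectorField I M) (x : M) : extDerivTwo Ω X Y Z x = 0 := by
  have sm (X : SmoothVectorField I M) : CMDiff ∞ (fun y ↦ β y (X y)) :=
    β.contMDiff_apply X.contMDiff
  have sm2 (X Y : SmoothVectorField I M) : CMDiff ∞ (dirDeriv X (fun y ↦ β y (Y y))) :=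
    contMDiff_dirDeriv X.contMDiff (sm Y)
  have md {f : M → ℝ} (hf : CMDiff ∞ f) : MDiffAt f x := hf.mdifferentiableAt_real x
  -- One summand of the cyclic sum. Under cyclic summation all derivative terms cancel, leaving the
  -- cyclic sum of `β([[X, Y], Z])`, which is zero by Jacobi (`jac`).
  have term (X Y Z : SmoothVectorField I M) : dirDeriv X (fun y ↦ Ω y (Y y) (Z y)) x
      - Ω x (VectorField.mlieBracket I X Y x) (Z x) =
      c * (dirDeriv X (dirDeriv Y (fun y ↦ β y (Z y))) x
        - dirDeriv X (dirDeriv Z (fun y ↦ β y (Y y))) x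
        - dirDeriv X (fun y ↦ β y (Y.bracket Z y)) x
        - (dirDeriv X (dirDeriv Y (fun y ↦ β y (Z y))) x
          - dirDeriv Y (dirDeriv X (fun y ↦ β y (Z y))) x
          - dirDeriv Z (fun y ↦ β y (X.bracket Y y)) x - β x ((X.bracket Y).bracket Z x))) := by
    have e1 : (fun y ↦ Ω y (Y y) (Z y)) = fun y ↦ c * (dirDeriv Y (fun y ↦ β y (Z y)) y
        - dirDeriv Z (fun y ↦ β y (Y y)) y - β y (Y.bracket Z y)) := by
      funext y
      rw [h]
      rfl
    have e2 : Ω x (VectorField.mlieBracket I X Y x) (Z x) = c * extDerivOne β (X.bracket Y) Z x :=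
      h (X.bracket Y) Z x
    have hs := ((sm2 Y Z).sub (sm2 Z Y))
    rw [e1, e2, dirDeriv_const_mul c (md (hs.sub (sm (Y.bracket Z)))),
      dirDeriv_sub_fun (md hs) (md (sm (Y.bracket Z))),
      dirDeriv_sub_fun (md (sm2 Y Z)) (md (sm2 Z Y)), extDerivOne,
      SmoothVectorField.dirDeriv_bracket _ _ (sm Z)]
    simp only [← SmoothVectorField.coe_bracket]
    ring
  have le2 : minSmoothness ℝ 2 ≤ ∞ := by
    simpa using (WithTop.coe_le_coe.2 le_top : ((2 : ℕ∞) : ℕ∞ω) ≤ ∞)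
  have jac : β x ((X.bracket Y).bracket Z x) + β x ((Y.bracket Z).bracket X x)
      + β x ((Z.bracket X).bracket Y x) = 0 := by
    have J := VectorField.leibniz_identity_mlieBracket_apply (I := I) (U := X) (V := Y) (W := Z)
      (x := x) ((X.contMDiff x).of_le le2) ((Y.contMDiff x).of_le le2) ((Z.contMDiff x).of_le le2)
    have e1 : (X.bracket Y).bracket Z x =
      VectorField.mlieBracket I (VectorField.mlieBracket I X Y) Z x := rfl
    have e2 : (Y.bracket Z).bracket X x =
      - VectorField.mlieBracket I X (VectorField.mlieBracket I Y Z) x :=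
      VectorField.mlieBracket_swap_apply
    have e3 : (Z.bracket X).bracket Y x =
      VectorField.mlieBracket I Y (VectorField.mlieBracket I X Z) x := by
      have h1 : VectorField.mlieBracket I (⇑Z) (⇑X) = (-1 : ℝ) • ⇑(X.bracket Z) := by
        rw [VectorField.mlieBracket_swap, SmoothVectorField.coe_bracket, neg_one_smul]
      rw [SmoothVectorField.coe_bracket, SmoothVectorField.coe_bracket,
        VectorField.mlieBracket_swap_apply, h1,
        VectorField.mlieBracket_const_smul_right ((X.bracket Z).mdiffAt x), neg_one_smul, neg_neg,
        SmoothVectorField.coe_bracket]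
    rw [e1, e2, e3, J, map_neg, map_add]
    ring
  rw [extDerivTwo]
  linear_combination term X Y Z + term Y Z X + term Z X Y + c * jac

end Fields

/-! ### Smoothness of tensor fields tested on smooth vector fields. -/

section Criterion

/-- In finite dimension `A` is the sum of `eᵢ* ⊗ A eᵢ` over a basis, so it depends linearly on its
finitely many columns. -/
theorem contMDiffAt_clm_of_forall_apply {E F G H N : Type*} [NormedAddCommGroup E]
    [NormedSpace ℝ E] [FiniteDimensional ℝ E]
    [NormedAddCommGroup F] [NormedSpace ℝ F] [NormedAddCommGroup G] [NormedSpace ℝ G]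
    [TopologicalSpace H] {J : ModelWithCorners ℝ G H}
    [TopologicalSpace N] [ChartedSpace H N] {p : N} {A : N → E →L[ℝ] F}
    (h : ∀ v, CMDiffAt ∞ (fun q ↦ A q v) p) : CMDiffAt ∞ A p := by
  set b := Module.finBasis ℝ E
  have e : A = fun q ↦ ∑ i, ContinuousLinearMap.smulRightL ℝ E F
      (LinearMap.toContinuousLinearMap (b.coord i)) (A q (b i)) := by
    funext q
    ext v
    refine (congrArg (A q) (b.sum_repr v).symm).trans ?_
    rw [map_sum, sum_apply]
    exact Finset.sum_congr rfl fun i _ ↦ map_smul _ _ _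
  rw [e]
  refine ContMDiffAt.sum fun i _ ↦ ?_
  exact (ContinuousLinearMap.contMDiff _).contMDiffAt.comp p (h (b i))

variable {E : Type*} [NormedAddCommGroup E] [NormedSpace ℝ E]
  {H : Type*} [TopologicalSpace H] {I : ModelWithCorners ℝ E H}
  {M : Type*} [TopologicalSpace M] [ChartedSpace H M] [IsManifold I ∞ M]
  [FiniteDimensional ℝ E] [CompleteSpace E] [T2Space M]
  {F : Type*} [NormedAddCommGroup F] [NormedSpace ℝ F]
  {V : M → Type*} [TopologicalSpace (Bundle.TotalSpace F V)]
  [∀ x, AddCommGroup (V x)] [∀ x, Module ℝ (V x)]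
  [∀ x : M, TopologicalSpace (V x)] [∀ x, IsTopologicalAddGroup (V x)]
  [∀ x, ContinuousSMul ℝ (V x)]
  [FiberBundle F V] [VectorBundle ℝ F V] [ContMDiffVectorBundle ∞ F V I]

/-- A field of linear maps out of the tangent bundle is smooth as soon as it maps
smooth vector fields to smooth sections. -/
theorem contMDiff_hom_of_forall_apply {A : Π x : M, TangentSpace I x →L[ℝ] V x}
    (h : ∀ X : SmoothVectorField I M,
      ContMDiff I (I.prod 𝓘(ℝ, F)) ∞ (fun x ↦ Bundle.TotalSpace.mk' F x (A x (X x)))) :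
    ContMDiff I (I.prod 𝓘(ℝ, E →L[ℝ] F)) ∞
      (fun x ↦ Bundle.TotalSpace.mk' (E →L[ℝ] F)
        (E := fun x : M ↦ TangentSpace I x →L[ℝ] V x) x (A x)) := by
  intro x₀
  rw [contMDiffAt_hom_bundle]
  refine ⟨contMDiffAt_id, contMDiffAt_clm_of_forall_apply fun v ↦ ?_⟩
  set t := trivializationAt E (TangentSpace I) x₀
  have hx₀ : x₀ ∈ t.baseSet := FiberBundle.mem_baseSet_trivializationAt' x₀
  -- Near `x₀` the field `X` is constant, equal to `v`, in the trivialization, so `A X` read in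
  -- coordinates is `v` under the coordinate matrix of `A`.
  obtain ⟨X, hX⟩ := exists_smoothVectorField_eventuallyEq_extend x₀ (t.symm x₀ v)
  refine ((Bundle.contMDiffAt_section _).1 (h X x₀)).congr_of_eventuallyEq ?_
  set t' := trivializationAt F V x₀
  have hx₀' : x₀ ∈ t'.baseSet := FiberBundle.mem_baseSet_trivializationAt' x₀
  filter_upwards [hX, t.open_baseSet.mem_nhds hx₀, t'.open_baseSet.mem_nhds hx₀'] with y hy h1 h2
  have e : FiberBundle.extend E (t.symm x₀ v) y = t.symm y v := by
    rw [FiberBundle.extend]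
    congr 1
    rw [t.mk_symm hx₀, t.apply_symm_apply (by rw [t.target_eq]; exact ⟨hx₀, Set.mem_univ _⟩)]
  rw [hy, e]
  simp [ContinuousLinearMap.inCoordinates_eq h1 h2, t']
  rfl

end Criterion

/-! ### Hitchin's lemma. -/

section Hitchin

variable {E : Type*} [NormedAddCommGroup E] [NormedSpace ℝ E]
  {H : Type*} [TopologicalSpace H] {I : ModelWithCorners ℝ E H}
  {M : Type*} [TopologicalSpace M] [ChartedSpace H M] [IsManifold I ∞ M]
  [FiniteDimensional ℝ E] [CompleteSpace E] [T2Space M]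
  {g : Bundle.ContMDiffRiemannianMetric I ∞ E (fun x : M ↦ TangentSpace I x)}

/-- If `A`, `J` and `K = A J` are anticommuting orthogonal almost complex structures and the
fundamental forms of `J` and `K` are closed, then `A` is integrable. -/
theorem nijenhuis_eq_zero_of_closed {A J K : SmoothEndField I M}
    (A_sq : ∀ x v, A x (A x v) = -v) (J_sq : ∀ x v, J x (J x v) = -v)
    (A_J : ∀ x v, A x (J x v) = K x v) (J_A : ∀ x v, J x (A x v) = - K x v)
    (A_orth : ∀ x v w, g.inner x (A x v) (A x w) = g.inner x v w)
    (hJ : ∀ (X Y Z : SmoothVectorField I M) (x : M),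
      extDerivTwo (fun y v w ↦ g.inner y v (J y w)) X Y Z x = 0)
    (hK : ∀ (X Y Z : SmoothVectorField I M) (x : M),
      extDerivTwo (fun y v w ↦ g.inner y v (K y w)) X Y Z x = 0)
    (X Y : SmoothVectorField I M) (x : M) : nijenhuis A X Y x = 0 := by
  -- The identities `k1` to `k4` say that `ω_J + i ω_K` is of type (2,0) for `A`: inserting `A` in
  -- either slot multiplies it by `i`.
  have k1 (y : M) (u v : TangentSpace I y) :
      g.inner y (A y u) (J y v) = - g.inner y u (K y v) := by
    rw [← A_orth, A_sq, A_J, map_neg, neg_apply]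
  have k2 (y : M) (u v : TangentSpace I y) :
      g.inner y u (J y (A y v)) = - g.inner y u (K y v) := by
    rw [J_A, map_neg]
  have k3 (y : M) (u v : TangentSpace I y) :
      g.inner y u (K y (A y v)) = g.inner y u (J y v) := by
    rw [← neg_inj, ← k2, A_sq, map_neg, map_neg]
  have k4 (y : M) (u v : TangentSpace I y) :
      g.inner y (A y u) (K y v) = g.inner y u (J y v) := by
    rw [← neg_inj, ← k1, A_sq, map_neg, neg_apply]
  -- In `dω_J(X,Y,Z) - dω_J(AX,AY,Z) - dω_K(AX,Y,Z) - dω_K(X,AY,Z)` every derivative term cancels by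
  -- the type identities; the bracket terms add up to this pairing.
  have zero (Z : SmoothVectorField I M) : g.inner x (nijenhuis A X Y x) (J x (Z x)) = 0 := by
    have h1 := hJ (A.appField X) (A.appField Y) Z x
    have h2 := hK (A.appField X) Y Z x
    have h3 := hK X (A.appField Y) Z x
    have h4 := hJ X Y Z x
    simp only [extDerivTwo, SmoothEndField.appField_apply, k1, k2, k3, k4,
      dirDeriv_neg_fun] at h1 h2 h3 h4
    have e := k1 x (VectorField.mlieBracket I (A.app X) Y x) (Z x)
    have e' := k1 x (VectorField.mlieBracket I X (A.app Y) x) (Z x)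
    rw [nijenhuis, A_sq]
    simp only [SmoothEndField.coe_appField] at h1 h2 h3
    simp only [map_add, map_sub, map_neg, add_apply, sub_apply, neg_apply]
    linear_combination h4 - h1 - h2 - h3 - e - e'
  -- With `Z = J N` one has `J Z = -N`, so the pairing is minus the squared length of `N`.
  obtain ⟨Z, hZ⟩ := exists_smoothVectorField_apply_eq x (J x (nijenhuis A X Y x))
  have h0 := zero Z
  rw [hZ, J_sq, map_neg, neg_eq_zero] at h0
  by_contra hne
  exact (g.pos x _ hne).ne' h0

theorem epsilonThree_self (a b : Fin 3) : epsilonThree a a b = 0 := by simp [epsilonThree]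

theorem AlmostHyperkahlerStructure.J_sq (S : AlmostHyperkahlerStructure g) (a : Fin 3) (x : M)
    (v : TangentSpace I x) : S.J a x (S.J a x v) = -v := by
  simp [S.quaternion, epsilonThree_self]

/-- Addition in `Fin 3` is cyclic, so `(a, a + 1, a + 2)` is always an even permutation. -/
theorem AlmostHyperkahlerStructure.J_mul_succ (S : AlmostHyperkahlerStructure g) (a : Fin 3) (x : M)
    (v : TangentSpace I x) : S.J a x (S.J (a + 1) x v) = S.J (a + 2) x v := by
  rw [S.quaternion]
  fin_cases a <;> simp [Fin.sum_univ_three, epsilonThree] <;> norm_num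

theorem AlmostHyperkahlerStructure.J_succ_mul (S : AlmostHyperkahlerStructure g) (a : Fin 3) (x : M)
    (v : TangentSpace I x) : S.J (a + 1) x (S.J a x v) = - S.J (a + 2) x v := by
  rw [S.quaternion]
  fin_cases a <;> simp [Fin.sum_univ_three, epsilonThree] <;> norm_num

/-- Hitchin's lemma: almost hyperkähler structures are integrable. -/
theorem AlmostHyperkahlerStructure.nijenhuis_eq_zero (S : AlmostHyperkahlerStructure g) (a : Fin 3)
    (X Y : SmoothVectorField I M) (x : M) : nijenhuis (S.J a) X Y x = 0 :=
  nijenhuis_eq_zero_of_closed (S.J_sq a) (S.J_sq (a + 1)) (S.J_mul_succ a) (S.J_succ_mul a)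
    (S.orthogonal a) (S.closed (a + 1)) (S.closed (a + 2)) X Y x

end Hitchin

/-! ### Vector fields on the cone and their brackets. -/

section ConeFields

variable {E : Type*} [NormedAddCommGroup E] [NormedSpace ℝ E]
  {H : Type*} [TopologicalSpace H] {I : ModelWithCorners ℝ E H}
  {M : Type*} [TopologicalSpace M] [ChartedSpace H M]

theorem coneRadius_pos (p : Cone M) : 0 < coneRadius p := p.2.2

theorem dirDeriv_coneRadius (W : Π p : Cone M, TangentSpace (coneModel I) p) (p : Cone M) :
    dirDeriv W coneRadius p = (W p).2 :=
  coneDr_apply p (W p)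

theorem dirDeriv_comp_fst (W : Π p : Cone M, TangentSpace (coneModel I) p) {u : M → ℝ}
    {p : Cone M} (hu : MDiffAt u p.1) :
    dirDeriv W (fun q : Cone M ↦ u q.1) p = mvfderiv I u p.1 (W p).1 := by
  have h := (hu.hasMFDerivAt.comp p (hasMFDerivAt_fst (I := I) (I' := 𝓘(ℝ, ℝ)) p)).mfderiv
  rw [dirDeriv, show (fun q : Cone M ↦ u q.1) = u ∘ Prod.fst from rfl]
  erw [h]
  rfl

variable [IsManifold I ∞ M]

/-- The constant field on `ℝ` pulled back along the inclusion, whose differential is the identity.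
It supplies the smoothness of `∂/∂r`. -/
theorem contMDiff_posReal_unit :
    ContMDiff 𝓘(ℝ, ℝ) 𝓘(ℝ, ℝ).tangent ∞
      (fun r : PosReal ↦ (⟨r, (1 : ℝ)⟩ : TangentBundle 𝓘(ℝ, ℝ) PosReal)) := by
  have h0 : ContMDiff 𝓘(ℝ, ℝ) 𝓘(ℝ, ℝ).tangent ∞
      (fun r : ℝ ↦ (⟨r, (1 : ℝ)⟩ : TangentBundle 𝓘(ℝ, ℝ) ℝ)) := by
    exact contMDiff_vectorSpace_iff_contDiff.2 contDiff_const
  have h := ContMDiff.mpullback_vectorField (I := 𝓘(ℝ, ℝ)) (n := ∞) (f := (Subtype.val : PosReal → ℝ)) h0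
    contMDiff_subtype_val (fun r ↦ by
      rw [(hasMFDerivAt_posReal_val r).mfderiv]
      exact ⟨ContinuousLinearEquiv.refl ℝ ℝ, rfl⟩) (by simp)
  have e (r : PosReal) :
      VectorField.mpullback 𝓘(ℝ, ℝ) 𝓘(ℝ, ℝ) (Subtype.val : PosReal → ℝ) (fun _ : ℝ ↦ (1 : ℝ)) r =
        (1 : ℝ) := by
    change (mfderiv 𝓘(ℝ, ℝ) 𝓘(ℝ, ℝ) (Subtype.val : PosReal → ℝ) r).inverse (1 : ℝ) = (1 : ℝ)
    rw [(hasMFDerivAt_posReal_val r).mfderiv]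
    erw [ContinuousLinearMap.inverse_id]
    rfl
  exact h.congr fun r ↦ congrArg (fun v ↦ (⟨r, v⟩ : TangentBundle 𝓘(ℝ, ℝ) PosReal)) (e r).symm

/-- A vector field on the cone is smooth if it is tangent to the slices and its component along `M`
is smooth. -/
theorem contMDiff_cone_horizontal {u : Π p : Cone M, TangentSpace I p.1}
    (hu : ContMDiff (coneModel I) I.tangent ∞
      (fun p : Cone M ↦ (⟨p.1, u p⟩ : TangentBundle I M))) :
    ContMDiff (coneModel I) (coneModel I).tangent ∞
      (fun p : Cone M ↦ (⟨p, ((u p, 0) : E × ℝ)⟩ : TangentBundle (coneModel I) (Cone M))) := by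
  have h0 : ContMDiff (coneModel I) 𝓘(ℝ, ℝ).tangent ∞
      (fun p : Cone M ↦ (⟨p.2, (0 : ℝ)⟩ : TangentBundle 𝓘(ℝ, ℝ) PosReal)) :=
    (Bundle.contMDiff_zeroSection ℝ (TangentSpace 𝓘(ℝ, ℝ) : PosReal → Type)).comp contMDiff_snd
  exact (contMDiff_equivTangentBundleProd_symm (I := I) (M := M) (I' := 𝓘(ℝ, ℝ))
    (M' := PosReal)).comp (hu.prodMk h0)

variable (I M) in
/-- The vector field `∂/∂r` on the cone. -/
def coneRadial : SmoothVectorField (coneModel I) (Cone M) :=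
  ⟨fun _ ↦ ((0, 1) : E × ℝ), by
    have h0 : ContMDiff (coneModel I) I.tangent ∞
        (fun p : Cone M ↦ (⟨p.1, (0 : E)⟩ : TangentBundle I M)) :=
      (Bundle.contMDiff_zeroSection ℝ (TangentSpace I : M → Type _)).comp contMDiff_fst
    exact (contMDiff_equivTangentBundleProd_symm (I := I) (M := M) (I' := 𝓘(ℝ, ℝ))
      (M' := PosReal)).comp (h0.prodMk (contMDiff_posReal_unit.comp contMDiff_snd))⟩

variable (I M) in
/-- The Euler vector field `r ∂/∂r` on the cone. -/
def coneEuler : SmoothVectorField (coneModel I) (Cone M) :=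
  SmoothVectorField.fsmul coneRadius contMDiff_coneRadius (coneRadial I M)

theorem coneEuler_apply (p : Cone M) : coneEuler I M p = ((0, coneRadius p) : E × ℝ) := by
  change coneRadius p • ((0, 1) : E × ℝ) = _
  simp

/-- The lift to the cone of a vector field on the base. -/
def coneLift (X : SmoothVectorField I M) : SmoothVectorField (coneModel I) (Cone M) :=
  ⟨fun p ↦ ((X p.1, 0) : E × ℝ), contMDiff_cone_horizontal (X.contMDiff.comp contMDiff_fst)⟩

theorem coneLift_apply (X : SmoothVectorField I M) (p : Cone M) :
    coneLift X p = ((X p.1, 0) : E × ℝ) := rfl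

theorem dirDeriv_coneLift_comp_fst (X : SmoothVectorField I M) {u : M → ℝ} (p : Cone M)
    (hu : MDiffAt u p.1) :
    dirDeriv (coneLift X) (fun q : Cone M ↦ u q.1) p = dirDeriv X u p.1 :=
  dirDeriv_comp_fst _ hu

theorem dirDeriv_coneLift_coneRadius (X : SmoothVectorField I M) (p : Cone M) :
    dirDeriv (coneLift X) coneRadius p = 0 :=
  dirDeriv_coneRadius _ p

theorem dirDeriv_coneEuler_comp_fst {u : M → ℝ} (p : Cone M) (hu : MDiffAt u p.1) :
    dirDeriv (coneEuler I M) (fun q : Cone M ↦ u q.1) p = 0 := by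
  rw [dirDeriv_comp_fst _ hu, coneEuler_apply]
  exact map_zero (mvfderiv I u p.1)

theorem dirDeriv_coneEuler_coneRadius (p : Cone M) :
    dirDeriv (coneEuler I M) coneRadius p = coneRadius p := by
  rw [dirDeriv_coneRadius, coneEuler_apply]

theorem dirDeriv_coneRadius_sq_mul (W : Π p : Cone M, TangentSpace (coneModel I) p) {f : Cone M → ℝ}
    {p : Cone M} (hf : MDifferentiableAt (coneModel I) 𝓘(ℝ, ℝ) f p) :
    dirDeriv W (fun q : Cone M ↦ coneRadius q ^ 2 * f q) p =
      coneRadius p ^ 2 * dirDeriv W f p + 2 * coneRadius p * (W p).2 * f p := by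
  have hr : MDifferentiableAt (coneModel I) 𝓘(ℝ, ℝ) (coneRadius : Cone M → ℝ) p :=
    (contMDiff_coneRadius (I := I)).mdifferentiableAt_real p
  have hrf : MDifferentiableAt (coneModel I) 𝓘(ℝ, ℝ) (fun q : Cone M ↦ coneRadius q * f q) p :=
    hr.mul hf
  have e : (fun q : Cone M ↦ coneRadius q ^ 2 * f q) =
      fun q ↦ coneRadius q * (coneRadius q * f q) := funext fun q ↦ by ring
  rw [e, dirDeriv_mul_fun hr hrf, dirDeriv_mul_fun hr hf, dirDeriv_coneRadius]
  ring

variable [FiniteDimensional ℝ E] [CompleteSpace E] [T2Space M]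

/-- Functions pulled back from `M` separate the `M`-components, and `r` separates the radial ones.
Brackets on the cone are computed by testing on these functions only. -/
theorem cone_eq_of_dirDeriv_eq {W W' : Π p : Cone M, TangentSpace (coneModel I) p} {p : Cone M}
    (h : ∀ u : M → ℝ, CMDiff ∞ u →
      dirDeriv W (fun q : Cone M ↦ u q.1) p = dirDeriv W' (fun q : Cone M ↦ u q.1) p)
    (hr : dirDeriv W coneRadius p = dirDeriv W' coneRadius p) : W p = W' p := by
  rw [dirDeriv_coneRadius, dirDeriv_coneRadius] at hr
  refine Prod.ext ?_ hr
  refine sub_eq_zero.1 (eq_zero_of_forall_mfderiv_eq_zero (I := I) (x := p.1)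
    (v := (W p).1 - (W' p).1) fun f hf ↦ ?_)
  have := h f hf
  rw [dirDeriv_comp_fst _ (hf.mdifferentiableAt_real _),
    dirDeriv_comp_fst _ (hf.mdifferentiableAt_real _)] at this
  exact (map_sub (mvfderiv I f p.1) _ _).trans (sub_eq_zero.2 this)

theorem contMDiff_comp_cone_fst {u : M → ℝ} (hu : CMDiff ∞ u) :
    ContMDiff (coneModel I) 𝓘(ℝ, ℝ) ∞ (fun q : Cone M ↦ u q.1) :=
  hu.comp contMDiff_fst

theorem coneLift_bracket (X Y : SmoothVectorField I M) :
    (coneLift X).bracket (coneLift Y) = coneLift (X.bracket Y) := by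
  refine ContMDiffSection.ext fun p ↦ cone_eq_of_dirDeriv_eq (fun u hu ↦ ?_) ?_
  · have e (Z : SmoothVectorField I M) : dirDeriv (coneLift Z) (fun q : Cone M ↦ u q.1) =
        fun q : Cone M ↦ dirDeriv Z u q.1 :=
      funext fun q ↦ dirDeriv_coneLift_comp_fst Z q (hu.mdifferentiableAt_real _)
    rw [SmoothVectorField.dirDeriv_bracket _ _ (contMDiff_comp_cone_fst hu), e, e, e,
      dirDeriv_coneLift_comp_fst _ _ ((contMDiff_dirDeriv Y.contMDiff hu).mdifferentiableAt_real _),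
      dirDeriv_coneLift_comp_fst _ _ ((contMDiff_dirDeriv X.contMDiff hu).mdifferentiableAt_real _),
      ← SmoothVectorField.dirDeriv_bracket _ _ hu]
  · have e (Z : SmoothVectorField I M) : dirDeriv (coneLift Z) (coneRadius (M := M)) = fun _ ↦ 0 :=
      funext fun q ↦ dirDeriv_coneLift_coneRadius Z q
    rw [SmoothVectorField.dirDeriv_bracket _ _ contMDiff_coneRadius, e, e, e, dirDeriv_const,
      dirDeriv_const, sub_zero]

/-- The flow of the Euler field consists of dilations in `r`, under which lifts are invariant. -/
theorem coneEuler_bracket_coneLift (X : SmoothVectorField I M) :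
    (coneEuler I M).bracket (coneLift X) = 0 := by
  refine ContMDiffSection.ext fun p ↦ cone_eq_of_dirDeriv_eq (fun u hu ↦ ?_) ?_
  · have e : dirDeriv (coneLift X) (fun q : Cone M ↦ u q.1) = fun q : Cone M ↦ dirDeriv X u q.1 :=
      funext fun q ↦ dirDeriv_coneLift_comp_fst X q (hu.mdifferentiableAt_real _)
    have e' : dirDeriv (coneEuler I M) (fun q : Cone M ↦ u q.1) = fun _ ↦ 0 :=
      funext fun q ↦ dirDeriv_coneEuler_comp_fst q (hu.mdifferentiableAt_real _)
    rw [SmoothVectorField.dirDeriv_bracket _ _ (contMDiff_comp_cone_fst hu), e, e',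
      dirDeriv_coneEuler_comp_fst _ ((contMDiff_dirDeriv X.contMDiff hu).mdifferentiableAt_real _),
      dirDeriv_const, sub_zero]
    exact (map_zero (mvfderiv (coneModel I) _ p)).symm
  · have e : dirDeriv (coneLift X) (coneRadius (M := M)) = fun _ ↦ 0 :=
      funext fun q ↦ dirDeriv_coneLift_coneRadius X q
    have e' : dirDeriv (coneEuler I M) (coneRadius (M := M)) = coneRadius :=
      funext fun q ↦ dirDeriv_coneEuler_coneRadius q
    rw [SmoothVectorField.dirDeriv_bracket _ _ contMDiff_coneRadius, e, e', dirDeriv_const,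
      dirDeriv_coneLift_coneRadius, sub_zero]
    exact (map_zero (mvfderiv (coneModel I) _ p)).symm

theorem exists_coneLift_add_smul_coneEuler (p : Cone M) (v : TangentSpace (coneModel I) p) :
    ∃ (X : SmoothVectorField I M) (c : ℝ), v = coneLift X p + c • coneEuler I M p := by
  obtain ⟨X, hX⟩ := exists_smoothVectorField_apply_eq (I := I) p.1 v.1
  refine ⟨X, v.2 / coneRadius p, ?_⟩
  rw [coneLift_apply, coneEuler_apply]
  refine Prod.ext ?_ ?_
  · have h : (v.1 : E) = v.1 + (v.2 / coneRadius p) • (0 : E) := by rw [smul_zero, add_zero]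
    rw [hX]
    exact h
  · change v.2 = 0 + (v.2 / coneRadius p) * coneRadius p
    rw [div_mul_cancel₀ _ (coneRadius_pos p).ne', zero_add]

/-- A tensor on the cone is determined by its values on lifts and on the Euler vector field. -/
theorem cone_tensor_eq {p : Cone M}
    {Φ : (Π q : Cone M, TangentSpace (coneModel I) q) →
      (Π q : Cone M, TangentSpace (coneModel I) q) → ℝ}
    (h₁ : ∀ Y, MDifferentiableAt (coneModel I) (coneModel I).tangent
      (fun q : Cone M ↦ (⟨q, Y q⟩ : TangentBundle (coneModel I) (Cone M))) p → TensorialAt (coneModel I) (E × ℝ) (Φ · Y) p)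
    (h₂ : ∀ X, MDifferentiableAt (coneModel I) (coneModel I).tangent
      (fun q : Cone M ↦ (⟨q, X q⟩ : TangentBundle (coneModel I) (Cone M))) p → TensorialAt (coneModel I) (E × ℝ) (Φ X ·) p)
    (B : TangentSpace (coneModel I) p →L[ℝ] TangentSpace (coneModel I) p →L[ℝ] ℝ)
    (hLL : ∀ X Y : SmoothVectorField I M,
      Φ (coneLift X) (coneLift Y) = B (coneLift X p) (coneLift Y p))
    (hLV : ∀ X : SmoothVectorField I M,
      Φ (coneLift X) (coneEuler I M) = B (coneLift X p) (coneEuler I M p))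
    (hVL : ∀ X : SmoothVectorField I M,
      Φ (coneEuler I M) (coneLift X) = B (coneEuler I M p) (coneLift X p))
    (hVV : Φ (coneEuler I M) (coneEuler I M) = B (coneEuler I M p) (coneEuler I M p))
    (X Y : SmoothVectorField (coneModel I) (Cone M)) : Φ X Y = B (X p) (Y p) := by
  have key (X Y : SmoothVectorField (coneModel I) (Cone M)) :
      TensorialAt.mkHom₂ Φ p h₁ h₂ (X p) (Y p) = Φ X Y :=
    TensorialAt.mkHom₂_apply h₁ h₂ (X.mdiffAt p) (Y.mdiffAt p)
  rw [← key]
  obtain ⟨A, a, hA⟩ := exists_coneLift_add_smul_coneEuler p (X p)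
  obtain ⟨C, c, hC⟩ := exists_coneLift_add_smul_coneEuler p (Y p)
  rw [hA, hC]
  simp only [map_add, map_smul, add_apply, smul_apply, key, hLL, hLV, hVL, hVV]

end ConeFields

/-! ### Lie derivative of a metric. -/

section LieDerivative

variable {E : Type*} [NormedAddCommGroup E] [NormedSpace ℝ E]
  {H : Type*} [TopologicalSpace H] {I : ModelWithCorners ℝ E H}
  {M : Type*} [TopologicalSpace M] [ChartedSpace H M] [IsManifold I ∞ M]

theorem mdifferentiableAt_metric_apply
    (g : Bundle.ContMDiffRiemannianMetric I ∞ E (fun x : M ↦ TangentSpace I x))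
    {X Y : Π x : M, TangentSpace I x} {x : M} (hX : MDiffAt (T% X) x) (hY : MDiffAt (T% Y) x) :
    MDiffAt (fun y ↦ g.inner y (X y) (Y y)) x := by
  have h := MDifferentiableAt.clm_bundle_apply₂ (E₃ := Bundle.Trivial M ℝ) (F₃ := ℝ)
    (g.contMDiff.mdifferentiableAt (by simp)) hX hY
  exact ((mdifferentiableAt_section _ _).1 h)

variable [FiniteDimensional ℝ E] [CompleteSpace E] [T2Space M]

/-- The Lie derivative of a metric `g` along a vector field `V`, evaluated on two vector fields. -/
def lieDerivMetric (g : Bundle.ContMDiffRiemannianMetric I ∞ E (fun x : M ↦ TangentSpace I x))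
    (V X Y : Π x : M, TangentSpace I x) (x : M) : ℝ :=
  dirDeriv V (fun y ↦ g.inner y (X y) (Y y)) x - g.inner x (VectorField.mlieBracket I V X x) (Y x)
    - g.inner x (X x) (VectorField.mlieBracket I V Y x)

variable (g : Bundle.ContMDiffRiemannianMetric I ∞ E (fun x : M ↦ TangentSpace I x))

theorem lieDerivMetric_swap (V X Y : Π x : M, TangentSpace I x) (x : M) :
    lieDerivMetric g V X Y x = lieDerivMetric g V Y X x := by
  rw [lieDerivMetric, lieDerivMetric, g.symm x (X x), g.symm x _ (Y x)]
  simp only [g.symm _ (X _)]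
  ring

theorem tensorialAt_lieDerivMetric_right (V : Π x : M, TangentSpace I x)
    {X : Π x : M, TangentSpace I x} {x : M} (hX : MDiffAt (T% X) x) :
    TensorialAt I E (fun Y : Π x : M, TangentSpace I x ↦ lieDerivMetric g V X Y x) x where
  smul {f Y} hf hY := by
    have e1 : (fun y ↦ g.inner y (X y) ((f • Y) y)) = fun y ↦ f y * g.inner y (X y) (Y y) :=
      funext fun y ↦ map_smul (g.inner y (X y)) _ _
    rw [lieDerivMetric, lieDerivMetric, e1,
      dirDeriv_mul_fun hf (mdifferentiableAt_metric_apply g hX hY),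
      mlieBracket_smul_right_dirDeriv hf hY, map_add, map_smul, map_smul, Pi.smul_apply', map_smul]
    simp only [smul_eq_mul]
    ring
  add {Y Z} hY hZ := by
    have e1 : (fun y ↦ g.inner y (X y) ((Y + Z) y)) =
        fun y ↦ g.inner y (X y) (Y y) + g.inner y (X y) (Z y) :=
      funext fun y ↦ map_add (g.inner y (X y)) _ _
    rw [lieDerivMetric, lieDerivMetric, lieDerivMetric, e1,
      dirDeriv_add_fun (mdifferentiableAt_metric_apply g hX hY)
        (mdifferentiableAt_metric_apply g hX hZ),
      VectorField.mlieBracket_add_right hY hZ, map_add, Pi.add_apply, map_add]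
    ring

theorem tensorialAt_lieDerivMetric_left (V : Π x : M, TangentSpace I x)
    {X : Π x : M, TangentSpace I x} {x : M} (hX : MDiffAt (T% X) x) :
    TensorialAt I E (fun Y : Π x : M, TangentSpace I x ↦ lieDerivMetric g V Y X x) x := by
  simp only [fun Y ↦ lieDerivMetric_swap g V Y X x]
  exact tensorialAt_lieDerivMetric_right g V hX

end LieDerivative

/-! ### Homothety of the cone metric and restriction to the unit slice. -/

section ConeLie

variable {E : Type*} [NormedAddCommGroup E] [NormedSpace ℝ E]
  {H : Type*} [TopologicalSpace H] {I : ModelWithCorners ℝ E H}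
  {M : Type*} [TopologicalSpace M] [ChartedSpace H M] [IsManifold I ∞ M]
  (g : Bundle.ContMDiffRiemannianMetric I ∞ E (fun x : M ↦ TangentSpace I x))

theorem coneMetric_inner_apply (p : Cone M) (v w : TangentSpace (coneModel I) p) :
    (coneMetric g).inner p v w = v.2 * w.2 + coneRadius p ^ 2 * g.inner p.1 v.1 w.1 :=
  coneInner_apply_coord g p v w

theorem coneLift_fst (X : SmoothVectorField I M) (p : Cone M) : (coneLift X p).1 = X p.1 := rfl

theorem coneLift_snd (X : SmoothVectorField I M) (p : Cone M) : (coneLift X p).2 = 0 := rfl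

theorem coneEuler_fst (p : Cone M) : (coneEuler I M p).1 = 0 := by rw [coneEuler_apply]

theorem coneEuler_snd (p : Cone M) : (coneEuler I M p).2 = coneRadius p := by rw [coneEuler_apply]

theorem coneMetric_inner_coneLift_right (p : Cone M) (v : TangentSpace (coneModel I) p)
    (X : SmoothVectorField I M) :
    (coneMetric g).inner p v (coneLift X p) = coneRadius p ^ 2 * g.inner p.1 v.1 (X p.1) := by
  rw [coneMetric_inner_apply, coneLift_snd, coneLift_fst, mul_zero, zero_add]

theorem coneMetric_inner_coneEuler_right (p : Cone M) (v : TangentSpace (coneModel I) p) :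
    (coneMetric g).inner p v (coneEuler I M p) = coneRadius p * v.2 := by
  have : g.inner p.1 v.1 (coneEuler I M p).1 = 0 := by
    rw [coneEuler_fst]
    exact map_zero (g.inner p.1 v.1)
  rw [coneMetric_inner_apply, this, coneEuler_snd]
  ring

theorem coneMetric_inner_coneEuler_left (p : Cone M) (v : TangentSpace (coneModel I) p) :
    (coneMetric g).inner p (coneEuler I M p) v = coneRadius p * v.2 := by
  rw [(coneMetric g).symm, coneMetric_inner_coneEuler_right]

variable [FiniteDimensional ℝ E] [CompleteSpace E] [T2Space M]

/-- Dilations scale the cone metric quadratically. Both sides are tensors, so lifts and `V` suffice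
as arguments; these commute with `V`, and the factor comes from `V(r²) = 2r²`. -/
theorem lieDerivMetric_coneEuler (X Y : SmoothVectorField (coneModel I) (Cone M)) (p : Cone M) :
    lieDerivMetric (coneMetric g) (coneEuler I M) X Y p =
      2 * (coneMetric g).inner p (X p) (Y p) := by
  have br (Z : SmoothVectorField I M) :
      VectorField.mlieBracket (coneModel I) (coneEuler I M) (coneLift Z) = 0 := by
    rw [← SmoothVectorField.coe_bracket, coneEuler_bracket_coneLift]
    rfl
  have hLL (A C : SmoothVectorField I M) :
      lieDerivMetric (coneMetric g) (coneEuler I M) (coneLift A) (coneLift C) p =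
        2 * (coneMetric g).inner p (coneLift A p) (coneLift C p) := by
    have hs := contMDiff_metric_apply g A C
    rw [lieDerivMetric, br, br, Pi.zero_apply, map_zero, map_zero, zero_apply]
    simp only [coneMetric_inner_coneLift_right, coneLift_fst]
    rw [dirDeriv_coneRadius_sq_mul _ ((contMDiff_comp_cone_fst hs).mdifferentiableAt_real p),
      dirDeriv_coneEuler_comp_fst p (hs.mdifferentiableAt_real _), coneEuler_snd]
    ring
  have hLV (A : SmoothVectorField I M) :
      lieDerivMetric (coneMetric g) (coneEuler I M) (coneLift A) (coneEuler I M) p =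
        2 * (coneMetric g).inner p (coneLift A p) (coneEuler I M p) := by
    rw [lieDerivMetric, br, VectorField.mlieBracket_self]
    simp only [Pi.zero_apply, map_zero, zero_apply, coneMetric_inner_coneEuler_right,
      coneLift_snd, mul_zero]
    rw [dirDeriv_const]
    ring
  refine cone_tensor_eq (I := I)
    (Φ := fun X Y ↦ lieDerivMetric (coneMetric g) (coneEuler I M) X Y p)
    (fun _ h ↦ tensorialAt_lieDerivMetric_left _ _ h)
    (fun _ h ↦ tensorialAt_lieDerivMetric_right _ _ h) ((2 : ℝ) • (coneMetric g).inner p)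
    hLL hLV (fun A ↦ ?_) ?_ X Y
  · rw [lieDerivMetric_swap, hLV, (coneMetric g).symm]
    rfl
  · rw [lieDerivMetric, VectorField.mlieBracket_self]
    simp only [Pi.zero_apply, map_zero, zero_apply, coneMetric_inner_coneEuler_right]
    have e : (fun q : Cone M ↦ coneRadius q * (coneEuler I M q).2) =
        fun q ↦ coneRadius q ^ 2 * (1 : ℝ) := by
      funext q
      rw [coneEuler_snd]
      ring
    rw [e, dirDeriv_coneRadius_sq_mul _ (contMDiff_const.mdifferentiableAt_real p), dirDeriv_const,
      smul_apply, smul_apply, coneMetric_inner_coneEuler_right, smul_eq_mul, coneEuler_snd]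
    ring

/-- The unit slice of the cone. -/
def coneUnit (x : M) : Cone M := (x, ⟨1, show (0 : ℝ) < 1 from one_pos⟩)

theorem coneRadius_coneUnit (x : M) : coneRadius (coneUnit x) = 1 := rfl

theorem contMDiff_coneUnit : ContMDiff I (coneModel I) ∞ (coneUnit : M → Cone M) :=
  contMDiff_id.prodMk contMDiff_const

theorem dirDeriv_coneLift_coneUnit (X : SmoothVectorField I M) {f : Cone M → ℝ} {x : M}
    (hf : ContMDiff (coneModel I) 𝓘(ℝ, ℝ) ∞ f) :
    dirDeriv (coneLift X) f (coneUnit x) = dirDeriv X (fun y ↦ f (coneUnit y)) x := by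
  have h1 : HasMFDerivAt I (coneModel I) (coneUnit : M → Cone M) x
      ((ContinuousLinearMap.id ℝ E).prod (0 : E →L[ℝ] ℝ)) :=
    (hasMFDerivAt_id x).prodMk (hasMFDerivAt_const _ x)
  have h := ((hf.mdifferentiableAt_real (coneUnit x)).hasMFDerivAt.comp x h1).mfderiv
  rw [dirDeriv, dirDeriv, show (fun y ↦ f (coneUnit y)) = f ∘ coneUnit from rfl]
  erw [h]
  rfl

/-- The exponential, as a map to the open half-line. -/
def expPosReal (s : ℝ) : PosReal := ⟨Real.exp s, Real.exp_pos s⟩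

theorem contMDiff_expPosReal : ContMDiff 𝓘(ℝ, ℝ) 𝓘(ℝ, ℝ) ∞ expPosReal := by
  intro s
  rw [contMDiffAt_iff_target]
  refine ⟨(Real.continuous_exp.subtype_mk _).continuousAt, ?_⟩
  have e : extChartAt 𝓘(ℝ, ℝ) (expPosReal s) ∘ expPosReal = Real.exp := by
    funext t
    simp [extChartAt]
    rfl
  rw [e]
  exact Real.contDiff_exp.contMDiff.contMDiffAt

theorem hasMFDerivAt_expPosReal (s : ℝ) : HasMFDerivAt 𝓘(ℝ, ℝ) 𝓘(ℝ, ℝ) expPosReal s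
    (ContinuousLinearMap.toSpanSingleton ℝ (Real.exp s) : ℝ →L[ℝ] ℝ) := by
  have h1 := (contMDiff_expPosReal.mdifferentiable (by simp) s).hasMFDerivAt
  have h2 := (hasMFDerivAt_posReal_val (expPosReal s)).comp s h1
  have h3 : HasMFDerivAt 𝓘(ℝ, ℝ) 𝓘(ℝ, ℝ) (Subtype.val ∘ expPosReal) s
    (ContinuousLinearMap.toSpanSingleton ℝ (Real.exp s) : ℝ →L[ℝ] ℝ) :=
    ((Real.hasDerivAt_exp s).hasFDerivAt).hasMFDerivAt
  have h4 := hasMFDerivAt_unique h2 h3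
  exact h4 ▸ h1

/-- A function of degree `2` under the Euler field is determined by its values on the unit slice. -/
theorem eq_coneRadius_sq_mul_of_dirDeriv {f : Cone M → ℝ}
    (hf : ContMDiff (coneModel I) 𝓘(ℝ, ℝ) ∞ f)
    (h : ∀ p, dirDeriv (coneEuler I M) f p = 2 * f p) (p : Cone M) :
    f p = coneRadius p ^ 2 * f (coneUnit p.1) := by
  -- The curve `s ↦ (x, exp s)` is an integral curve of the Euler field, so along it the hypothesis
  -- is the equation `f' = 2f`.
  have hd (s : ℝ) : HasDerivAt (fun s ↦ f (p.1, expPosReal s)) (2 * f (p.1, expPosReal s)) s := by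
    have h1 : HasMFDerivAt 𝓘(ℝ, ℝ) (coneModel I) (fun s ↦ ((p.1, expPosReal s) : Cone M)) s
        ((0 : ℝ →L[ℝ] E).prod (ContinuousLinearMap.toSpanSingleton ℝ (Real.exp s) : ℝ →L[ℝ] ℝ)) :=
      (hasMFDerivAt_const _ s).prodMk (hasMFDerivAt_expPosReal s)
    have h2 := (hf.mdifferentiableAt_real (p.1, expPosReal s)).hasMFDerivAt.comp s h1
    let L : ℝ →L[ℝ] ℝ :=
      (mfderiv (coneModel I) 𝓘(ℝ, ℝ) f (p.1, expPosReal s) : E × ℝ →L[ℝ] ℝ).comp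
        ((0 : ℝ →L[ℝ] E).prod
          (ContinuousLinearMap.toSpanSingleton ℝ (Real.exp s) : ℝ →L[ℝ] ℝ))
    have h3 : HasFDerivAt (fun s ↦ f (p.1, expPosReal s)) L s :=
      hasMFDerivAt_iff_hasFDerivAt.1 h2
    have e : ((0 : ℝ →L[ℝ] E).prod
        (ContinuousLinearMap.toSpanSingleton ℝ (Real.exp s) : ℝ →L[ℝ] ℝ)) 1 =
        ((0, Real.exp s) : E × ℝ) := by simp
    have e' : 2 * f (p.1, expPosReal s) = L 1 := by
      change _ = mvfderiv (coneModel I) f (p.1, expPosReal s) (((0 : ℝ →L[ℝ] E).prod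
        (ContinuousLinearMap.toSpanSingleton ℝ (Real.exp s) : ℝ →L[ℝ] ℝ)) 1)
      rw [← h, dirDeriv, coneEuler_apply, e]
      rfl
    rw [e']
    exact h3.hasDerivAt
  have hc (s : ℝ) : HasDerivAt (fun s ↦ Real.exp (-2 * s) * f (p.1, expPosReal s)) 0 s := by
    have := (((hasDerivAt_id s).const_mul (-2)).exp).mul (hd s)
    exact this.congr_deriv (by simp only [id]; ring)
  -- The constant `exp(-2s) f` is compared at `s = log r`, the given point, and at `s = 0`, the unit
  -- slice.
  have h0 := is_const_of_deriv_eq_zero (fun s ↦ (hc s).differentiableAt) (fun s ↦ (hc s).deriv)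
    (Real.log (coneRadius p)) 0
  have e1 : expPosReal (Real.log (coneRadius p)) = p.2 :=
    Subtype.ext (Real.exp_log (coneRadius_pos p))
  have e2 : expPosReal 0 = ⟨1, show (0 : ℝ) < 1 from one_pos⟩ := Subtype.ext Real.exp_zero
  have e3 : Real.exp (-2 * Real.log (coneRadius p)) = (coneRadius p ^ 2)⁻¹ := by
    rw [neg_mul, Real.exp_neg, two_mul, Real.exp_add, Real.exp_log (coneRadius_pos p), sq]
  simp only [e1, e2, e3, mul_zero, Real.exp_zero, one_mul] at h0
  have hr := coneRadius_pos p
  change (coneRadius p ^ 2)⁻¹ * f p = f (coneUnit p.1) at h0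
  rw [← h0]
  field_simp

theorem contMDiff_fst_coneField (W : SmoothVectorField (coneModel I) (Cone M)) :
    ContMDiff (coneModel I) I.tangent ∞
      (fun p : Cone M ↦ (⟨p.1, (W p).1⟩ : TangentBundle I M)) := by
  have h := ((contMDiff_fst (I := I) (J := 𝓘(ℝ, ℝ)) (M := M) (N := PosReal)
    (n := ∞)).contMDiff_tangentMap (m := ∞) (by simp)).comp W.contMDiff
  refine h.congr fun p ↦ ?_
  refine congrArg (fun v ↦ (⟨p.1, v⟩ : TangentBundle I M)) ?_
  exact (coneProjDeriv_apply p (W p)).symm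

/-- The component along `M` of a vector field on the cone, on the unit slice. -/
def unitSliceField (W : SmoothVectorField (coneModel I) (Cone M)) : SmoothVectorField I M :=
  ⟨fun x ↦ (W (coneUnit x)).1, (contMDiff_fst_coneField W).comp (contMDiff_coneUnit (I := I))⟩

theorem contMDiff_snd_coneField (W : SmoothVectorField (coneModel I) (Cone M)) :
    ContMDiff (coneModel I) 𝓘(ℝ, ℝ) ∞ (fun p : Cone M ↦ (W p).2) :=
  (contMDiff_dirDeriv W.contMDiff contMDiff_coneRadius).congr fun p ↦
    (dirDeriv_coneRadius W p).symm

end ConeLie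

/-! ### Pointwise algebra of contact metric structures and 3-structures. -/

section ContactAlgebra

variable {E : Type*} [NormedAddCommGroup E] [NormedSpace ℝ E]
  {H : Type*} [TopologicalSpace H] {I : ModelWithCorners ℝ E H}
  {M : Type*} [TopologicalSpace M] [ChartedSpace H M] [IsManifold I ∞ M]
  {g : Bundle.ContMDiffRiemannianMetric I ∞ E (fun x : M ↦ TangentSpace I x)}

namespace ContactMetricStructure

variable (S : ContactMetricStructure g)

/-- Since `Φ²ξ = 0`, the formula for `Φ²` applied to `Φξ` gives `Φξ = c ξ`; then `0 = Φ²ξ = c² ξ`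
forces `c = 0`. -/
theorem Phi_xi (x : M) : S.Phi x (S.xi x) = 0 := by
  have h2 : S.Phi x (S.Phi x (S.xi x)) = 0 := by
    rw [S.Phi_sq, S.eta_xi, one_smul, neg_add_cancel]
  have h3 : S.Phi x (S.xi x) = S.eta x (S.Phi x (S.xi x)) • S.xi x := by
    have := S.Phi_sq x (S.Phi x (S.xi x))
    rw [h2, map_zero] at this
    rw [eq_comm, ← sub_eq_zero]
    rw [sub_eq_neg_add]
    exact this.symm
  set c := S.eta x (S.Phi x (S.xi x))
  rw [h3, map_smul, h3, smul_smul] at h2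
  have h4 := congrArg (S.eta x) h2
  rw [map_smul, S.eta_xi, map_zero, smul_eq_mul, mul_one, mul_self_eq_zero] at h4
  rw [h3, h4, zero_smul]

/-- Compare `Φ ∘ Φ²` with `Φ² ∘ Φ`. -/
theorem eta_Phi (x : M) (v : TangentSpace I x) : S.eta x (S.Phi x v) = 0 := by
  have h := congrArg (S.Phi x) (S.Phi_sq x v)
  rw [S.Phi_sq, map_add, map_neg, map_smul, S.Phi_xi, smul_zero, add_zero, add_eq_left] at h
  have h' := congrArg (S.eta x) h
  rwa [map_smul, S.eta_xi, map_zero, smul_eq_mul, mul_one] at h'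

theorem inner_xi (x : M) (v : TangentSpace I x) : g.inner x v (S.xi x) = S.eta x v := by
  have h := S.compatible x v (S.xi x)
  rw [S.Phi_xi, map_zero, S.eta_xi, mul_one] at h
  linarith

theorem inner_Phi_left (x : M) (v w : TangentSpace I x) :
    g.inner x (S.Phi x v) w = - g.inner x v (S.Phi x w) := by
  have h := S.compatible x v (S.Phi x w)
  rw [S.Phi_sq, S.eta_Phi, map_add, map_smul, S.inner_xi, S.eta_Phi, map_neg] at h
  simp at h
  linarith

/-- This is orthogonality of the cone's `J` for `dr² + r² g`, written in components, with `s` and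
`t` the radial parts. -/
theorem inner_cone_components (x : M) (u w : TangentSpace I x) (s t : ℝ) {r : ℝ} (hr : r ≠ 0) :
    (r * S.eta x u) * (r * S.eta x w) +
      r ^ 2 * g.inner x (-(S.Phi x u) - (r⁻¹ * s) • S.xi x) (-(S.Phi x w) - (r⁻¹ * t) • S.xi x) =
    s * t + r ^ 2 * g.inner x u w := by
  simp only [map_sub, map_neg, map_smul, sub_apply, neg_apply, smul_apply, S.inner_xi,
    S.compatible, S.eta_Phi, S.eta_xi, g.symm x (S.xi x), smul_eq_mul]
  field_simp
  ring

variable [FiniteDimensional ℝ E] [CompleteSpace E] [T2Space M]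

/-- Split `Y = -Φ(ΦY) + η(Y) ξ`: the Reeb condition kills the second part and `associated` evaluates
the first. -/
theorem extDerivOne_eta (X Y : SmoothVectorField I M) (x : M) :
    extDerivOne S.eta X Y x = -(2 * g.inner x (X x) (S.Phi x (Y x))) := by
  -- The coefficient is frozen at `x`; this is harmless because `dη` depends only on the values of
  -- its arguments at `x`.
  set c : ℝ := S.eta x (Y x)
  let A : SmoothVectorField I M := (-1 : ℝ) • S.Phi.appField (S.Phi.appField Y)
  let B : SmoothVectorField I M := c • S.xi
  let Z : SmoothVectorField I M := A + B
  have hZ : Y x = Z x := by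
    have : Z x = (-1 : ℝ) • S.Phi x (S.Phi x (Y x)) + c • S.xi x := rfl
    rw [this, S.Phi_sq]
    module
  have e : ⇑Z = ⇑A + ⇑B := rfl
  have e1 : extDerivOne S.eta X A x =
      -1 * extDerivOne S.eta X (S.Phi.appField (S.Phi.appField Y)) x :=
    extDerivOne_smul_right S.eta X (S.Phi.appField (S.Phi.appField Y)) (f := fun _ ↦ (-1 : ℝ))
      mdifferentiableAt_const
  have e2 : extDerivOne S.eta X B x = c * extDerivOne S.eta X S.xi x :=
    extDerivOne_smul_right S.eta X S.xi (f := fun _ ↦ c) mdifferentiableAt_const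
  rw [extDerivOne_congr S.eta (X' := X) (Y' := Z) rfl hZ, e, extDerivOne_add_right,
    e1, e2, SmoothEndField.coe_appField, S.associated, extDerivOne_swap S.eta X S.xi, S.reeb,
    SmoothEndField.appField_apply, S.eta_Phi]
  ring

end ContactMetricStructure

namespace ContactThreeStructure

variable (S : ContactThreeStructure g)

/-- For distinct indices, evaluating the `(a, b)` relation on `ξᵇ` removes `ΦᵃΦᵇξᵇ` and leaves `ξᵃ =
εᵃᵇᶜ Φᶜξᵇ` with `c` the third index. -/
theorem Phi_xi (a b : Fin 3) (x : M) : (S.str a).Phi x ((S.str b).xi x) =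
    -∑ c, epsilonThree a b c • (S.str c).xi x := by
  have h1 := S.relations 0 1 x ((S.str 1).xi x)
  have h2 := S.relations 1 0 x ((S.str 0).xi x)
  have h3 := S.relations 0 2 x ((S.str 2).xi x)
  have h4 := S.relations 2 0 x ((S.str 0).xi x)
  have h5 := S.relations 1 2 x ((S.str 2).xi x)
  have h6 := S.relations 2 1 x ((S.str 1).xi x)
  simp only [ContactMetricStructure.Phi_xi, ContactMetricStructure.eta_xi, map_zero, one_smul,
    Fin.sum_univ_three] at h1 h2 h3 h4 h5 h6
  simp [epsilonThree] at h1 h2 h3 h4 h5 h6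
  norm_num at h1 h2 h3 h4 h5 h6
  fin_cases a <;> fin_cases b <;> simp [Fin.sum_univ_three, epsilonThree] <;> norm_num <;>
    first
    | exact ContactMetricStructure.Phi_xi _ _
    | exact h1.symm
    | exact h4.symm
    | exact h5.symm
    | exact eq_neg_of_add_eq_zero_left (by rw [h2, add_neg_cancel])
    | exact eq_neg_of_add_eq_zero_left (by rw [h3, add_neg_cancel])
    | exact eq_neg_of_add_eq_zero_left (by rw [h6, add_neg_cancel])

/-- Apply `ηᵃ` to `Φᵃξᵇ = ± ξᶜ` and use `ηᵃ ∘ Φᵃ = 0`. -/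
theorem eta_xi (a b : Fin 3) (x : M) :
    (S.str a).eta x ((S.str b).xi x) = if a = b then 1 else 0 := by
  have h (a b : Fin 3) := congrArg ((S.str a).eta x) (S.Phi_xi a b x)
  simp only [ContactMetricStructure.eta_Phi, Fin.sum_univ_three] at h
  have h1 := h 0 1
  have h2 := h 0 2
  have h3 := h 1 0
  have h4 := h 1 2
  have h5 := h 2 0
  have h6 := h 2 1
  simp [epsilonThree] at h1 h2 h3 h4 h5 h6
  norm_num at h1 h2 h3 h4 h5 h6
  fin_cases a <;> fin_cases b <;> simp [ContactMetricStructure.eta_xi, *]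

/-- The metric transpose of `Phi_xi`: `Φᵇ` is skew and `ηᵃ` is dual to `ξᵃ`. -/
theorem eta_Phi (a b : Fin 3) (x : M) (v : TangentSpace I x) :
    (S.str a).eta x ((S.str b).Phi x v) = -∑ c, epsilonThree a b c * (S.str c).eta x v := by
  have e (c : Fin 3) : epsilonThree a b c = - epsilonThree b a c := by
    simp only [epsilonThree]
    ring
  rw [← (S.str a).inner_xi, (S.str b).inner_Phi_left, S.Phi_xi, map_neg, map_sum]
  simp only [map_smul, smul_eq_mul, ContactMetricStructure.inner_xi, e, neg_neg, neg_mul,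
    Finset.sum_neg_distrib]

/-- The `M`-component of the quaternion relation on the cone at `(u, t)`. The minus sign in `J = -Φ
+ ...` is what turns `-εΦ` in the contact relations into `+εJ`. -/
theorem cone_quaternion_fst (a b : Fin 3) (x : M) (u : TangentSpace I x) (t : ℝ) {r : ℝ}
    (hr : r ≠ 0) :
    -((S.str a).Phi x (-((S.str b).Phi x u) - (r⁻¹ * t) • (S.str b).xi x)) -
        (r⁻¹ * (r * (S.str b).eta x u)) • (S.str a).xi x =
      (∑ c, epsilonThree a b c • (-((S.str c).Phi x u) - (r⁻¹ * t) • (S.str c).xi x)) -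
        (if a = b then (1 : ℝ) else 0) • u := by
  have h := S.relations a b x u
  have e : (if a = b then u else 0) = (if a = b then (1 : ℝ) else 0) • u := by
    split_ifs <;> simp
  rw [sub_eq_iff_eq_add, e] at h
  rw [map_sub, map_neg, map_smul, h, S.Phi_xi, inv_mul_cancel_left₀ hr]
  simp only [smul_sub, smul_neg, Finset.sum_sub_distrib, Finset.sum_neg_distrib,
    smul_comm _ (r⁻¹ * t), ← Finset.smul_sum]
  abel

theorem cone_quaternion_snd (a b : Fin 3) (x : M) (u : TangentSpace I x) (t : ℝ) {r : ℝ}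
    (hr : r ≠ 0) :
    r * (S.str a).eta x (-((S.str b).Phi x u) - (r⁻¹ * t) • (S.str b).xi x) =
      (∑ c, epsilonThree a b c * (r * (S.str c).eta x u)) -
        (if a = b then (1 : ℝ) else 0) * t := by
  rw [map_sub, map_neg, map_smul, S.eta_Phi, S.eta_xi, neg_neg, mul_sub, Finset.mul_sum]
  congr 1
  · exact Finset.sum_congr rfl fun c _ ↦ by ring
  · rw [smul_eq_mul]
    field_simp

end ContactThreeStructure

end ContactAlgebra

/-! ### From a contact 3-structure to an almost hyperkähler cone. -/

section ConeConstruction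

variable {E : Type*} [NormedAddCommGroup E] [NormedSpace ℝ E]
  {H : Type*} [TopologicalSpace H] {I : ModelWithCorners ℝ E H}
  {M : Type*} [TopologicalSpace M] [ChartedSpace H M] [IsManifold I ∞ M]
  [FiniteDimensional ℝ E] [CompleteSpace E] [T2Space M]

/-- The smooth vector field on the cone which is tangent to the slices, with prescribed component
along `M`. -/
def coneHorizontal (u : Π p : Cone M, TangentSpace I p.1)
    (hu : ContMDiff (coneModel I) I.tangent ∞
      (fun p : Cone M ↦ (⟨p.1, u p⟩ : TangentBundle I M))) :
    SmoothVectorField (coneModel I) (Cone M) :=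
  ⟨fun p ↦ ((u p, 0) : E × ℝ), contMDiff_cone_horizontal hu⟩

/-- The 1-form `r² η` on the cone, at a point. -/
def coneFormAt (η : SmoothOneForm I M) (p : Cone M) : TangentSpace (coneModel I) p →L[ℝ] ℝ :=
  coneRadius p ^ 2 • (η p.1).comp (coneProjDeriv I p)

theorem coneFormAt_apply (η : SmoothOneForm I M) (p : Cone M) (v : TangentSpace (coneModel I) p) :
    coneFormAt η p v = coneRadius p ^ 2 * η p.1 v.1 := by
  change coneRadius p ^ 2 • η p.1 (coneProjDeriv I p v) = _
  rw [coneProjDeriv_apply, smul_eq_mul]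

theorem contMDiff_eta_fst_coneField (η : SmoothOneForm I M)
    (X : SmoothVectorField (coneModel I) (Cone M)) :
    ContMDiff (coneModel I) 𝓘(ℝ, ℝ) ∞ (fun p : Cone M ↦ η p.1 (X p).1) := by
  have h := ContMDiff.clm_bundle_apply (E₂ := Bundle.Trivial M ℝ) (F₂ := ℝ)
    (η.contMDiff.comp (contMDiff_fst (I := I) (J := 𝓘(ℝ, ℝ)) (N := PosReal)))
    (contMDiff_fst_coneField X)
  exact fun p ↦ (Bundle.contMDiffAt_totalSpace.1 (h p)).2

/-- The 1-form `r² η` on the cone. -/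
def coneForm (η : SmoothOneForm I M) : SmoothOneForm (coneModel I) (Cone M) :=
  ⟨coneFormAt η, contMDiff_hom_of_forall_apply (V := Bundle.Trivial (Cone M) ℝ) fun X p ↦
    (Bundle.contMDiffAt_section p).2 (by
      have h := ((contMDiff_coneRadius (I := I) (M := M)).pow 2).mul
        (contMDiff_eta_fst_coneField η X)
      exact (h.congr fun p ↦ coneFormAt_apply η p (X p)) p)⟩

theorem coneForm_apply (η : SmoothOneForm I M) (p : Cone M) (v : TangentSpace (coneModel I) p) :
    coneForm η p v = coneRadius p ^ 2 * η p.1 v.1 := coneFormAt_apply η p v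

variable {g : Bundle.ContMDiffRiemannianMetric I ∞ E (fun x : M ↦ TangentSpace I x)}
  (S : ContactMetricStructure g)

/-- The almost complex structure on the cone of a contact metric structure, at a point. -/
def coneComplexAt (p : Cone M) :
    TangentSpace (coneModel I) p →L[ℝ] TangentSpace (coneModel I) p :=
  (-((S.Phi p.1).comp (coneProjDeriv I p)) -
    ((coneRadius p)⁻¹ • coneDr I p).smulRight (S.xi p.1) :
      TangentSpace (coneModel I) p →L[ℝ] TangentSpace I p.1).prod
    (coneRadius p • (S.eta p.1).comp (coneProjDeriv I p))

theorem coneComplexAt_fst (p : Cone M) (v : TangentSpace (coneModel I) p) :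
    (coneComplexAt S p v).1 = -(S.Phi p.1 v.1) - ((coneRadius p)⁻¹ * v.2) • S.xi p.1 := by
  change -(S.Phi p.1 (coneProjDeriv I p v)) -
    ((coneRadius p)⁻¹ * coneDr I p v) • S.xi p.1 = _
  rw [coneProjDeriv_apply, coneDr_apply]

theorem coneComplexAt_snd (p : Cone M) (v : TangentSpace (coneModel I) p) :
    (coneComplexAt S p v).2 = coneRadius p * S.eta p.1 v.1 := by
  change coneRadius p * S.eta p.1 (coneProjDeriv I p v) = _
  rw [coneProjDeriv_apply]

theorem contMDiff_Phi_fst_coneField (X : SmoothVectorField (coneModel I) (Cone M)) :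
    ContMDiff (coneModel I) I.tangent ∞
      (fun p : Cone M ↦ (⟨p.1, S.Phi p.1 (X p).1⟩ : TangentBundle I M)) :=
  ContMDiff.clm_bundle_apply
    (S.Phi.contMDiff.comp (contMDiff_fst (I := I) (J := 𝓘(ℝ, ℝ)) (N := PosReal)))
    (contMDiff_fst_coneField X)

theorem contMDiff_coneRadius_inv :
    ContMDiff (coneModel I) 𝓘(ℝ, ℝ) ∞ (fun p : Cone M ↦ (coneRadius p)⁻¹) :=
  fun p ↦ (contMDiff_coneRadius p).inv₀ (coneRadius_pos p).ne'

/-- The almost complex structure on the cone of a contact metric structure. -/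
def coneComplex : SmoothEndField (coneModel I) (Cone M) :=
  ⟨coneComplexAt S, contMDiff_hom_of_forall_apply fun X ↦ by
    let W : SmoothVectorField (coneModel I) (Cone M) :=
      - coneHorizontal (fun p ↦ S.Phi p.1 (X p).1) (contMDiff_Phi_fst_coneField S X)
      - SmoothVectorField.fsmul _ ((contMDiff_coneRadius_inv (I := I)).mul
          (contMDiff_snd_coneField X)) (coneLift S.xi)
      + SmoothVectorField.fsmul _ ((contMDiff_coneRadius (I := I)).mul
          (contMDiff_eta_fst_coneField S.eta X)) (coneRadial I M)
    refine W.contMDiff.congr fun p ↦ ?_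
    refine congrArg (fun v ↦ (⟨p, v⟩ : TangentBundle (coneModel I) (Cone M))) ?_
    refine Prod.ext ?_ ?_
    · rw [coneComplexAt_fst]
      change _ = -(S.Phi p.1 (X p).1) - ((coneRadius p)⁻¹ * (X p).2) • S.xi p.1 +
        (coneRadius p * S.eta p.1 (X p).1) • (0 : TangentSpace I p.1)
      rw [smul_zero, add_zero]
    · rw [coneComplexAt_snd]
      change _ = - 0 - ((coneRadius p)⁻¹ * (X p).2) * 0 + (coneRadius p * S.eta p.1 (X p).1) * 1
      ring⟩

theorem coneComplex_fst (p : Cone M) (v : TangentSpace (coneModel I) p) :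
    (coneComplex S p v).1 = -(S.Phi p.1 v.1) - ((coneRadius p)⁻¹ * v.2) • S.xi p.1 :=
  coneComplexAt_fst S p v

theorem coneComplex_snd (p : Cone M) (v : TangentSpace (coneModel I) p) :
    (coneComplex S p v).2 = coneRadius p * S.eta p.1 v.1 :=
  coneComplexAt_snd S p v

theorem coneMetric_inner_coneComplex_fst (p : Cone M) (v w : TangentSpace (coneModel I) p) :
    g.inner p.1 v.1 (coneComplex S p w).1 =
      -g.inner p.1 v.1 (S.Phi p.1 w.1) - (coneRadius p)⁻¹ * w.2 * S.eta p.1 v.1 := by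
  have h := S.inner_xi p.1 v.1
  rw [coneComplex_fst, map_sub, map_neg, map_smul, ← h, smul_eq_mul]

theorem coneComplex_orthogonal (p : Cone M) (v w : TangentSpace (coneModel I) p) :
    (coneMetric g).inner p (coneComplex S p v) (coneComplex S p w) =
      (coneMetric g).inner p v w := by
  rw [coneMetric_inner_apply, coneMetric_inner_apply, coneComplex_snd, coneComplex_snd,
    coneComplex_fst, coneComplex_fst]
  exact S.inner_cone_components p.1 v.1 w.1 v.2 w.2 (coneRadius_pos p).ne'

/-- The fundamental form of the almost complex structure on the cone is `½ d(r² η)`. -/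
theorem coneComplex_fundamental (X Y : SmoothVectorField (coneModel I) (Cone M)) (p : Cone M) :
    (coneMetric g).inner p (X p) (coneComplex S p (Y p)) =
      1 / 2 * extDerivOne (coneForm S.eta) X Y p := by
  have hr := coneRadius_pos p
  have eLift (A : SmoothVectorField I M) : (fun q ↦ coneForm S.eta q (coneLift A q)) =
      fun q : Cone M ↦ coneRadius q ^ 2 * S.eta q.1 (A q.1) :=
    funext fun q ↦ coneForm_apply _ _ _
  have eEuler : (fun q ↦ coneForm S.eta q (coneEuler I M q)) = fun q : Cone M ↦ (0 : ℝ) :=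
    funext fun q ↦ by
      rw [coneForm_apply, coneEuler_fst]
      exact mul_eq_zero_of_right _ (map_zero (S.eta q.1))
  have sm (A : SmoothVectorField I M) : CMDiff ∞ (fun x ↦ S.eta x (A x)) :=
    S.eta.contMDiff_apply A.contMDiff
  -- Lifts do not differentiate `r`, so this is `r²` times the formula for `dη` on the base.
  have hLL (A C : SmoothVectorField I M) : extDerivOne (coneForm S.eta) (coneLift A) (coneLift C) p =
      2 * (coneMetric g).inner p (coneLift A p) (coneComplex S p (coneLift C p)) := by
    have h := S.extDerivOne_eta A C p.1
    rw [extDerivOne] at h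
    rw [extDerivOne, eLift, eLift, ← SmoothVectorField.coe_bracket, coneLift_bracket,
      coneForm_apply, coneLift_fst,
      dirDeriv_coneRadius_sq_mul _ ((contMDiff_comp_cone_fst (sm A)).mdifferentiableAt_real p),
      dirDeriv_coneRadius_sq_mul _ ((contMDiff_comp_cone_fst (sm C)).mdifferentiableAt_real p),
      dirDeriv_coneLift_comp_fst _ p ((sm A).mdifferentiableAt_real _),
      dirDeriv_coneLift_comp_fst _ p ((sm C).mdifferentiableAt_real _), coneMetric_inner_apply,
      coneMetric_inner_coneComplex_fst, coneLift_fst, coneLift_fst, coneLift_snd, coneLift_snd,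
      SmoothVectorField.coe_bracket]
    linear_combination coneRadius p ^ 2 * h
  have hVL (C : SmoothVectorField I M) : extDerivOne (coneForm S.eta) (coneEuler I M) (coneLift C) p =
      2 * (coneMetric g).inner p (coneEuler I M p) (coneComplex S p (coneLift C p)) := by
    rw [extDerivOne, eLift, eEuler, ← SmoothVectorField.coe_bracket, coneEuler_bracket_coneLift,
      dirDeriv_const,
      dirDeriv_coneRadius_sq_mul _ ((contMDiff_comp_cone_fst (sm C)).mdifferentiableAt_real p),
      dirDeriv_coneEuler_comp_fst p ((sm C).mdifferentiableAt_real _),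
      coneMetric_inner_coneEuler_left, coneComplex_snd, coneEuler_snd, coneLift_fst,
      ContMDiffSection.coe_zero, Pi.zero_apply, map_zero]
    ring
  have hLV (C : SmoothVectorField I M) : extDerivOne (coneForm S.eta) (coneLift C) (coneEuler I M) p =
      2 * (coneMetric g).inner p (coneLift C p) (coneComplex S p (coneEuler I M p)) := by
    have e : g.inner p.1 (C p.1) (S.Phi p.1 (coneEuler I M p).1) = 0 := by
      rw [coneEuler_fst]
      exact (congrArg (g.inner p.1 (C p.1)) (map_zero (S.Phi p.1))).trans
        (map_zero (g.inner p.1 (C p.1)))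
    rw [extDerivOne_swap, hVL, coneMetric_inner_coneEuler_left, coneComplex_snd,
      coneMetric_inner_apply, coneMetric_inner_coneComplex_fst, coneLift_fst, coneLift_snd, e,
      coneEuler_snd]
    field_simp
    ring
  let B : TangentSpace (coneModel I) p →L[ℝ] TangentSpace (coneModel I) p →L[ℝ] ℝ :=
    let h : (E × ℝ) →L[ℝ] (E × ℝ) →L[ℝ] ℝ := (coneMetric g).inner p
    let J : (E × ℝ) →L[ℝ] (E × ℝ) := coneComplex S p
    (2 : ℝ) • (h.flip.comp J).flip
  have hB (u v : TangentSpace (coneModel I) p) :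
      B u v = 2 * (coneMetric g).inner p u (coneComplex S p v) := rfl
  have hVV : extDerivOne (coneForm S.eta) (coneEuler I M) (coneEuler I M) p = 0 := by
    linarith [extDerivOne_swap (coneForm S.eta) (coneEuler I M) (coneEuler I M) p]
  have hJV : (coneMetric g).inner p (coneEuler I M p) (coneComplex S p (coneEuler I M p)) = 0 := by
    rw [coneMetric_inner_coneEuler_left, coneComplex_snd, coneEuler_fst]
    exact mul_eq_zero_of_right _ (mul_eq_zero_of_right _ (map_zero (S.eta p.1)))
  -- Both sides are tensorial, so the four cases on lifts and the Euler field determine them.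
  have h := cone_tensor_eq (I := I) (p := p) (Φ := fun X Y ↦ extDerivOne (coneForm S.eta) X Y p)
    (fun _ _ ↦ tensorialAt_extDerivOne_left _ _ _)
    (fun _ _ ↦ tensorialAt_extDerivOne_right _ _ _) B
    (fun A C ↦ (hLL A C).trans (hB _ _).symm) (fun A ↦ (hLV A).trans (hB _ _).symm)
    (fun A ↦ (hVL A).trans (hB _ _).symm) (by rw [hB, hVV, hJV, mul_zero]) X Y
  rw [h, hB]
  ring

/-- A contact 3-structure induces an almost hyperkähler structure on the cone. -/
theorem isAlmostHyperkahler_coneMetric (h : HasContactThreeStructure g) :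
    IsAlmostHyperkahler (coneMetric g) := by
  obtain ⟨S⟩ := h
  refine ⟨⟨fun a ↦ coneComplex (S.str a), fun a b p v ↦ ?_,
    fun a ↦ coneComplex_orthogonal (S.str a), fun a X Y Z p ↦
      extDerivTwo_eq_zero_of_extDerivOne (coneForm (S.str a).eta) (1 / 2)
        (coneComplex_fundamental (S.str a)) X Y Z p⟩⟩
  have hr := (coneRadius_pos p).ne'
  have h1 := S.cone_quaternion_fst a b p.1 v.1 v.2 hr
  have h2 := S.cone_quaternion_snd a b p.1 v.1 v.2 hr
  rw [Fin.sum_univ_three] at h1 h2 ⊢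
  have e0 := coneComplex_fst (S.str 0) p v
  have e1 := coneComplex_fst (S.str 1) p v
  have e2 := coneComplex_fst (S.str 2) p v
  have f0 := coneComplex_snd (S.str 0) p v
  have f1 := coneComplex_snd (S.str 1) p v
  have f2 := coneComplex_snd (S.str 2) p v
  have e : (if a = b then v else 0) = (if a = b then (1 : ℝ) else 0) • v := by
    split_ifs <;> simp
  rw [e]
  refine Prod.ext ?_ ?_
  · rw [coneComplex_fst, coneComplex_fst, coneComplex_snd]
    refine h1.trans ?_
    rw [← e0, ← e1, ← e2]
    rfl
  · rw [coneComplex_snd, coneComplex_fst]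
    refine h2.trans ?_
    rw [← f0, ← f1, ← f2]
    rfl

end ConeConstruction

/-! ### Invariance of the complex structures under the Euler field. -/

section HomotheticComplex

variable {E : Type*} [NormedAddCommGroup E] [NormedSpace ℝ E]
  {H : Type*} [TopologicalSpace H] {I : ModelWithCorners ℝ E H}
  {M : Type*} [TopologicalSpace M] [ChartedSpace H M] [IsManifold I ∞ M]
  {g : Bundle.ContMDiffRiemannianMetric I ∞ E (fun x : M ↦ TangentSpace I x)}

namespace AlmostHyperkahlerStructure

theorem inner_J_left (S : AlmostHyperkahlerStructure g) (a : Fin 3) (x : M)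
    (v w : TangentSpace I x) : g.inner x (S.J a x v) w = - g.inner x v (S.J a x w) := by
  have h := S.orthogonal a x v (S.J a x w)
  have h2 : S.J a x (S.J a x w) = -w := by simp [S.quaternion, epsilonThree]
  rw [h2, map_neg] at h
  linarith

theorem inner_J_swap (S : AlmostHyperkahlerStructure g) (a : Fin 3) (x : M)
    (v w : TangentSpace I x) : g.inner x v (S.J a x w) = - g.inner x w (S.J a x v) := by
  rw [← S.inner_J_left, g.symm]

end AlmostHyperkahlerStructure

variable [FiniteDimensional ℝ E] [CompleteSpace E] [T2Space M]

/-- The 1-form dual to the Euler field is closed. -/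
theorem coneEuler_dual_closed (g : Bundle.ContMDiffRiemannianMetric I ∞ E
      (fun x : M ↦ TangentSpace I x))
    (X Y : SmoothVectorField (coneModel I) (Cone M)) (p : Cone M) :
    dirDeriv X (fun q ↦ (coneMetric g).inner q (coneEuler I M q) (Y q)) p
      - dirDeriv Y (fun q ↦ (coneMetric g).inner q (coneEuler I M q) (X q)) p
      - (coneMetric g).inner p (coneEuler I M p) (X.bracket Y p) = 0 := by
  have hr := contMDiff_coneRadius (I := I) (M := M)
  -- The dual form is `r dr = d(r²/2)`.
  have e (Z : SmoothVectorField (coneModel I) (Cone M)) :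
      (fun q ↦ (coneMetric g).inner q (coneEuler I M q) (Z q)) =
        fun q : Cone M ↦ coneRadius q * dirDeriv Z coneRadius q := funext fun q ↦ by
    rw [coneMetric_inner_coneEuler_left, dirDeriv_coneRadius]
  have e' : (coneMetric g).inner p (coneEuler I M p) (X.bracket Y p) =
      coneRadius p * dirDeriv (X.bracket Y) coneRadius p := congrFun (e (X.bracket Y)) p
  rw [e, e, e', dirDeriv_mul_fun (hr.mdifferentiableAt_real p)
      ((contMDiff_dirDeriv Y.contMDiff hr).mdifferentiableAt_real p),
    dirDeriv_mul_fun (hr.mdifferentiableAt_real p)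
      ((contMDiff_dirDeriv X.contMDiff hr).mdifferentiableAt_real p),
    SmoothVectorField.dirDeriv_bracket _ _ hr]
  ring

namespace AlmostHyperkahlerStructure

variable (S : AlmostHyperkahlerStructure (coneMetric g)) (a : Fin 3)

/-- The exterior derivative of the 1-form `V ⌟ ω`, for the Euler field `V`. -/
def extDerivEuler (X Y : SmoothVectorField (coneModel I) (Cone M)) (p : Cone M) : ℝ :=
  dirDeriv X (fun q ↦ (coneMetric g).inner q (coneEuler I M q) (S.J a q (Y q))) p
    - dirDeriv Y (fun q ↦ (coneMetric g).inner q (coneEuler I M q) (S.J a q (X q))) p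
    - (coneMetric g).inner p (coneEuler I M p) (S.J a p (X.bracket Y p))

/-- Cartan's formula with `dω = 0` gives `d(V ⌟ ω) = L_V ω`; the Leibniz rule for `ω = h(·, J ·)`
and `L_V h = 2h` then yield `2ω + h(·, (L_V J) ·)`. -/
theorem extDerivEuler_eq (X Y : SmoothVectorField (coneModel I) (Cone M)) (p : Cone M) :
    S.extDerivEuler a X Y p = 2 * (coneMetric g).inner p (X p) (S.J a p (Y p)) +
      ((coneMetric g).inner p (X p) ((coneEuler I M).bracket ((S.J a).appField Y) p) -
        (coneMetric g).inner p (X p) (S.J a p ((coneEuler I M).bracket Y p))) := by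
  have h := S.closed a (coneEuler I M) X Y p
  have h2 := lieDerivMetric_coneEuler g X ((S.J a).appField Y) p
  have e : VectorField.mlieBracket (coneModel I) (⇑Y) (⇑(coneEuler I M)) p =
      - (coneEuler I M).bracket Y p := VectorField.mlieBracket_swap_apply
  have e1 : (fun q ↦ (coneMetric g).inner q (Y q) (S.J a q (coneEuler I M q))) =
      fun q ↦ - (coneMetric g).inner q (coneEuler I M q) (S.J a q (Y q)) :=
    funext fun q ↦ S.inner_J_swap a q _ _
  rw [extDerivTwo, e, e1, dirDeriv_neg_fun, S.inner_J_swap a p (VectorField.mlieBracket _ X Y p),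
    map_neg, neg_apply, S.inner_J_swap a p ((coneEuler I M).bracket Y p)] at h
  rw [lieDerivMetric] at h2
  simp only [SmoothEndField.appField_apply] at h2
  simp only [extDerivEuler, SmoothVectorField.coe_bracket] at h ⊢
  linarith

/-- For integrable `J` and closed `α`, the form `d(α ∘ J)` is `J`-invariant; here `α = V♭`.
Closedness enters on the pairs `(X, JY)` and `(JX, Y)`, and integrability through `α(J N(X, Y)) =
0`. -/
theorem extDerivEuler_J_J (X Y : SmoothVectorField (coneModel I) (Cone M)) (p : Cone M) :
    S.extDerivEuler a ((S.J a).appField X) ((S.J a).appField Y) p = S.extDerivEuler a X Y p := by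
  have h1 := coneEuler_dual_closed g X ((S.J a).appField Y) p
  have h2 := coneEuler_dual_closed g ((S.J a).appField X) Y p
  have hN := congrArg (fun v ↦ (coneMetric g).inner p (coneEuler I M p) (S.J a p v))
    (S.nijenhuis_eq_zero a X Y p)
  simp only [nijenhuis, map_add, map_sub, S.J_sq, map_neg, map_zero] at hN
  have e (Y : SmoothVectorField (coneModel I) (Cone M)) :
      (fun q ↦ (coneMetric g).inner q (coneEuler I M q) (S.J a q ((S.J a).appField Y q))) =
      fun q ↦ - (coneMetric g).inner q (coneEuler I M q) (Y q) := funext fun q ↦ by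
    rw [SmoothEndField.appField_apply, S.J_sq, map_neg]
  rw [extDerivEuler, extDerivEuler, e, e, dirDeriv_neg_fun, dirDeriv_neg_fun]
  simp only [SmoothVectorField.coe_bracket, SmoothEndField.coe_appField,
    SmoothEndField.app] at h1 h2 hN ⊢
  linarith

/-- The Euler field preserves the complex structures of a hyperkähler structure on a cone. -/
theorem coneEuler_bracket_J (Y : SmoothVectorField (coneModel I) (Cone M)) (p : Cone M) :
    (coneEuler I M).bracket ((S.J a).appField Y) p = S.J a p ((coneEuler I M).bracket Y p) := by
  have h0 (X : SmoothVectorField (coneModel I) (Cone M)) :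
      (coneMetric g).inner p (X p) ((coneEuler I M).bracket ((S.J a).appField Y) p) -
        (coneMetric g).inner p (X p) (S.J a p ((coneEuler I M).bracket Y p)) = 0 := by
    -- Replacing `(X, Y)` by `(JX, JY)` fixes `d(V ⌟ ω)` and `2ω` but reverses the sign of `h(X,
    -- (L_V J) Y)`, which must therefore vanish.
    have h := S.extDerivEuler_J_J a X Y p
    have e : (coneEuler I M).bracket ((S.J a).appField ((S.J a).appField Y)) p =
        -(coneEuler I M).bracket Y p := by
      have : ⇑((S.J a).appField ((S.J a).appField Y)) = (-1 : ℝ) • ⇑Y := funext fun q ↦ by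
        rw [Pi.smul_apply, neg_one_smul]
        exact S.J_sq a q (Y q)
      rw [SmoothVectorField.coe_bracket, this,
        VectorField.mlieBracket_const_smul_right (Y.mdiffAt p), neg_one_smul]
      rfl
    rw [extDerivEuler_eq, extDerivEuler_eq, e, SmoothEndField.appField_apply, S.orthogonal,
      S.orthogonal, SmoothEndField.appField_apply, map_neg, S.inner_J_left] at h
    linarith
  refine sub_eq_zero.1 ?_
  obtain ⟨X, hX⟩ := exists_smoothVectorField_apply_eq (I := coneModel I) p
    ((coneEuler I M).bracket ((S.J a).appField Y) p - S.J a p ((coneEuler I M).bracket Y p))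
  have h := h0 X
  rw [← map_sub, hX] at h
  by_contra hne
  exact ((coneMetric g).pos p _ hne).ne' h

theorem extDerivEuler_eq_two_mul (X Y : SmoothVectorField (coneModel I) (Cone M)) (p : Cone M) :
    S.extDerivEuler a X Y p = 2 * (coneMetric g).inner p (X p) (S.J a p (Y p)) := by
  rw [extDerivEuler_eq, coneEuler_bracket_J, sub_self, add_zero]

end AlmostHyperkahlerStructure

end HomotheticComplex

/-! ### Dilation-invariant fields and the unit slice. -/

section UnitSlice

variable {E : Type*} [NormedAddCommGroup E] [NormedSpace ℝ E]
  {H : Type*} [TopologicalSpace H] {I : ModelWithCorners ℝ E H}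
  {M : Type*} [TopologicalSpace M] [ChartedSpace H M]

variable (I) in
/-- The differential of the inclusion of the unit slice in the cone. -/
def coneUnitDeriv (x : M) : TangentSpace I x →L[ℝ] TangentSpace (coneModel I) (coneUnit x) :=
  ContinuousLinearMap.inl ℝ E ℝ

variable (I) in
/-- The differential of the projection of the cone, on the unit slice. -/
def coneUnitProj (x : M) : TangentSpace (coneModel I) (coneUnit x) →L[ℝ] TangentSpace I x :=
  coneProjDeriv I (coneUnit x)

theorem coneUnitProj_apply (x : M) (v : TangentSpace (coneModel I) (coneUnit x)) :
    coneUnitProj I x v = v.1 :=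
  coneProjDeriv_apply _ _

theorem coneUnitProj_coneUnitDeriv (x : M) (v : TangentSpace I x) :
    coneUnitProj I x (coneUnitDeriv I x v) = v :=
  coneProjDeriv_apply _ _

theorem coneDr_coneUnitDeriv (x : M) (v : TangentSpace I x) :
    coneDr I (coneUnit x) (coneUnitDeriv I x v) = 0 :=
  coneDr_apply _ _

variable [IsManifold I ∞ M]

theorem coneProjDeriv_coneEuler (p : Cone M) : coneProjDeriv I p (coneEuler I M p) = 0 := by
  rw [coneProjDeriv_apply, coneEuler_fst]
  rfl

theorem coneDr_coneEuler (p : Cone M) : coneDr I p (coneEuler I M p) = coneRadius p := by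
  rw [coneDr_apply, coneEuler_snd]

theorem coneLift_coneUnit (X : SmoothVectorField I M) (x : M) :
    coneLift X (coneUnit x) = coneUnitDeriv I x (X x) := rfl

theorem cone_tangent_ext {p : Cone M} {v w : TangentSpace (coneModel I) p}
    (h1 : coneProjDeriv I p v = coneProjDeriv I p w) (h2 : coneDr I p v = coneDr I p w) :
    v = w := by
  rw [coneProjDeriv_apply, coneProjDeriv_apply] at h1
  rw [coneDr_apply, coneDr_apply] at h2
  exact Prod.ext h1 h2

variable [FiniteDimensional ℝ E] [CompleteSpace E] [T2Space M]

theorem coneUnitProj_coneEuler (x : M) : coneUnitProj I x (coneEuler I M (coneUnit x)) = 0 :=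
  coneProjDeriv_coneEuler _

theorem coneUnit_decomposition (x : M) (v : TangentSpace (coneModel I) (coneUnit x)) :
    v = coneUnitDeriv I x (coneUnitProj I x v) +
      coneDr I (coneUnit x) v • coneEuler I M (coneUnit x) := by
  have h : coneUnitProj I x v = coneUnitProj I x (coneUnitDeriv I x (coneUnitProj I x v) +
      coneDr I (coneUnit x) v • coneEuler I M (coneUnit x)) := by
    rw [map_add, map_smul, coneUnitProj_coneUnitDeriv, coneUnitProj_coneEuler, smul_zero,
      add_zero]
  refine cone_tangent_ext h ?_
  rw [map_add, map_smul, coneDr_coneUnitDeriv, coneDr_coneEuler, coneRadius_coneUnit,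
    smul_eq_mul, mul_one, zero_add]

variable (g : Bundle.ContMDiffRiemannianMetric I ∞ E (fun x : M ↦ TangentSpace I x))

theorem coneMetric_inner_coneUnit (x : M) (v w : TangentSpace (coneModel I) (coneUnit x)) :
    (coneMetric g).inner (coneUnit x) v w = coneDr I _ v * coneDr I _ w +
      g.inner x (coneUnitProj I x v) (coneUnitProj I x w) := by
  refine (coneInner_apply g (coneUnit x) v w).trans ?_
  rw [coneRadius_coneUnit, one_pow, one_mul]
  rfl

/-- When `W` and `Z` commute with `V`, the identity `L_V h = 2h` reduces to `V(h(W, Z)) = 2 h(W,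
Z)`. -/
theorem eq_coneRadius_sq_mul_inner_of_bracket {W Z : SmoothVectorField (coneModel I) (Cone M)}
    (hW : (coneEuler I M).bracket W = 0) (hZ : (coneEuler I M).bracket Z = 0) (p : Cone M) :
    (coneMetric g).inner p (W p) (Z p) = coneRadius p ^ 2 *
      (coneMetric g).inner (coneUnit p.1) (W (coneUnit p.1)) (Z (coneUnit p.1)) := by
  refine eq_coneRadius_sq_mul_of_dirDeriv (contMDiff_metric_apply (coneMetric g) W Z)
    (fun q ↦ ?_) p
  have h := lieDerivMetric_coneEuler g W Z q
  rw [lieDerivMetric, ← SmoothVectorField.coe_bracket, ← SmoothVectorField.coe_bracket, hW, hZ,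
    ContMDiffSection.coe_zero, Pi.zero_apply, map_zero, map_zero, zero_apply, sub_zero,
    sub_zero] at h
  exact h

theorem coneEuler_bracket_self : (coneEuler I M).bracket (coneEuler I M) = 0 :=
  ContMDiffSection.ext fun p ↦ congrFun VectorField.mlieBracket_self p

/-- A vector field commuting with the Euler field is determined by its values on the unit slice. -/
theorem coneField_eq_of_bracket
    (g : Bundle.ContMDiffRiemannianMetric I ∞ E (fun x : M ↦ TangentSpace I x))
    {W : SmoothVectorField (coneModel I) (Cone M)}
    (hW : (coneEuler I M).bracket W = 0) (p : Cone M) :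
    W p = coneLift (unitSliceField W) p +
      coneDr I (coneUnit p.1) (W (coneUnit p.1)) • coneEuler I M p := by
  have hr := coneRadius_pos p
  refine cone_tangent_ext ?_ ?_
  · rw [map_add, map_smul, coneProjDeriv_coneEuler, smul_zero, add_zero, coneProjDeriv_apply,
      coneProjDeriv_apply, coneLift_fst]
    refine sub_eq_zero.1 ?_
    set u : TangentSpace I p.1 := (W p).1
    set w : TangentSpace I p.1 := unitSliceField W p.1
    change u - w = 0
    -- Pairing with the lift of the difference itself shows that it has length zero; the radial part
    -- is found by pairing with `V`.
    obtain ⟨Z, hZ⟩ := exists_smoothVectorField_apply_eq (I := I) p.1 (u - w)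
    have h := eq_coneRadius_sq_mul_inner_of_bracket g hW (coneEuler_bracket_coneLift Z) p
    rw [coneMetric_inner_coneLift_right, coneMetric_inner_coneLift_right, coneRadius_coneUnit,
      one_pow, one_mul] at h
    have h1 : g.inner p.1 u (Z p.1) = g.inner p.1 w (Z p.1) :=
      mul_left_cancel₀ (pow_pos hr 2).ne' h
    have h2 : g.inner p.1 (u - w) (u - w) = 0 := by
      rw [hZ] at h1
      rw [map_sub, g.symm _ _ u, g.symm _ _ w, h1, sub_self]
    by_contra hne
    exact (g.pos _ _ hne).ne' h2
  · have h := eq_coneRadius_sq_mul_inner_of_bracket g hW coneEuler_bracket_self p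
    rw [coneMetric_inner_coneEuler_right, coneMetric_inner_coneEuler_right,
      coneRadius_coneUnit, one_mul, ← coneDr_apply, ← coneDr_apply] at h
    rw [map_add, map_smul, coneDr_coneEuler, coneDr_apply p (coneLift _ p), coneLift_snd, zero_add,
      smul_eq_mul]
    refine mul_left_cancel₀ hr.ne' (h.trans ?_)
    ring

/-- The vector field `X + b V` on the cone, for a vector field `X` and a function `b` on the
base. -/
def coneLiftAdd (X : SmoothVectorField I M) (b : M → ℝ) (hb : CMDiff ∞ b) :
    SmoothVectorField (coneModel I) (Cone M) :=
  coneLift X + SmoothVectorField.fsmul (fun p ↦ b p.1) (contMDiff_comp_cone_fst hb) (coneEuler I M)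

theorem coneLiftAdd_apply (X : SmoothVectorField I M) (b : M → ℝ) (hb : CMDiff ∞ b) (p : Cone M) :
    coneLiftAdd X b hb p = coneLift X p + b p.1 • coneEuler I M p := rfl

theorem coneLift_eq_coneLiftAdd (X : SmoothVectorField I M) :
    coneLift X = coneLiftAdd X (fun _ ↦ 0) contMDiff_const :=
  ContMDiffSection.ext fun p ↦ by rw [coneLiftAdd_apply, zero_smul, add_zero]

/-- `V` commutes with lifts and annihilates functions pulled back from `M`, so only the derivatives
of the coefficients along `X` and `Y` contribute. This reduces the brackets in the Nijenhuis tensor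
of `J` to brackets on `M`. -/
theorem coneLiftAdd_bracket (X Y : SmoothVectorField I M) {a b : M → ℝ} (ha : CMDiff ∞ a)
    (hb : CMDiff ∞ b) (p : Cone M) :
    (coneLiftAdd X a ha).bracket (coneLiftAdd Y b hb) p =
      coneLift (X.bracket Y) p + (dirDeriv X b p.1 - dirDeriv Y a p.1) • coneEuler I M p := by
  have hr := contMDiff_coneRadius (I := I) (M := M)
  have d1 (Z : SmoothVectorField I M) {c u : M → ℝ} (hc : CMDiff ∞ c) (hu : CMDiff ∞ u) :
      dirDeriv (coneLiftAdd Z c hc) (fun q : Cone M ↦ u q.1) = fun q ↦ dirDeriv Z u q.1 :=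
    funext fun q ↦ by
      rw [coneLiftAdd, ContMDiffSection.coe_add, dirDeriv_add, SmoothVectorField.coe_fsmul,
        dirDeriv_smul, dirDeriv_coneLift_comp_fst _ _ (hu.mdifferentiableAt_real _),
        dirDeriv_coneEuler_comp_fst _ (hu.mdifferentiableAt_real _), mul_zero, add_zero]
  have d2 (Z : SmoothVectorField I M) {c : M → ℝ} (hc : CMDiff ∞ c) :
      dirDeriv (coneLiftAdd Z c hc) coneRadius = fun q : Cone M ↦ c q.1 * coneRadius q :=
    funext fun q ↦ by
      rw [coneLiftAdd, ContMDiffSection.coe_add, dirDeriv_add, SmoothVectorField.coe_fsmul,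
        dirDeriv_smul, dirDeriv_coneLift_coneRadius, dirDeriv_coneEuler_coneRadius, zero_add]
  have hs : CMDiff ∞ (fun x ↦ dirDeriv X b x - dirDeriv Y a x) :=
    (contMDiff_dirDeriv X.contMDiff hb).sub (contMDiff_dirDeriv Y.contMDiff ha)
  rw [← coneLiftAdd_apply (X.bracket Y) _ hs]
  refine cone_eq_of_dirDeriv_eq (fun u hu ↦ ?_) ?_
  · rw [SmoothVectorField.dirDeriv_bracket _ _ (contMDiff_comp_cone_fst hu), d1 _ _ hu, d1 _ _ hu,
      d1 _ _ hu, d1 _ _ (contMDiff_dirDeriv Y.contMDiff hu),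
      d1 _ _ (contMDiff_dirDeriv X.contMDiff hu)]
    exact (SmoothVectorField.dirDeriv_bracket X Y hu p.1).symm
  · have hd {c : M → ℝ} (hc : CMDiff ∞ c) :=
      (contMDiff_comp_cone_fst (I := I) hc).mdifferentiableAt_real p
    rw [SmoothVectorField.dirDeriv_bracket _ _ hr, d2, d2, d2,
      dirDeriv_mul_fun (hd ha) (hr.mdifferentiableAt_real p),
      dirDeriv_mul_fun (hd hb) (hr.mdifferentiableAt_real p), d1 _ _ ha, d1 _ _ hb, d2, d2]
    ring

end UnitSlice

/-! ### From an almost hyperkähler cone to a 3-Sasakian base. -/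

section InducedContact

variable {E : Type*} [NormedAddCommGroup E] [NormedSpace ℝ E]
  {H : Type*} [TopologicalSpace H] {I : ModelWithCorners ℝ E H}
  {M : Type*} [TopologicalSpace M] [ChartedSpace H M] [IsManifold I ∞ M]
  [FiniteDimensional ℝ E] [CompleteSpace E] [T2Space M]
  {g : Bundle.ContMDiffRiemannianMetric I ∞ E (fun x : M ↦ TangentSpace I x)}

namespace AlmostHyperkahlerStructure

variable (S : AlmostHyperkahlerStructure (coneMetric g)) (a : Fin 3)

/-- The contact form on the unit slice induced by a complex structure of the cone. -/
def inducedEta : SmoothOneForm I M :=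
  ⟨fun x ↦ (coneDr I (coneUnit x)).comp ((S.J a (coneUnit x)).comp (coneUnitDeriv I x)),
    contMDiff_hom_of_forall_apply (V := Bundle.Trivial M ℝ) fun X x ↦
      (Bundle.contMDiffAt_section x).2 (by
        have h := (contMDiff_snd_coneField ((S.J a).appField (coneLift X))).comp
          (contMDiff_coneUnit (I := I))
        exact (h.congr fun y ↦ coneDr_apply _ _) x)⟩

theorem inducedEta_apply (x : M) (v : TangentSpace I x) :
    S.inducedEta a x v = coneDr I (coneUnit x) (S.J a (coneUnit x) (coneUnitDeriv I x v)) := rfl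

/-- The structure tensor on the unit slice induced by a complex structure of the cone. -/
def inducedPhi : SmoothEndField I M :=
  ⟨fun x ↦ -((coneUnitProj I x).comp ((S.J a (coneUnit x)).comp (coneUnitDeriv I x))),
    contMDiff_hom_of_forall_apply fun X ↦ by
      refine (-unitSliceField ((S.J a).appField (coneLift X))).contMDiff.congr fun x ↦ ?_
      refine congrArg (fun v ↦ (⟨x, v⟩ : TangentBundle I M)) ?_
      exact congrArg Neg.neg (coneUnitProj_apply x _)⟩

theorem inducedPhi_apply (x : M) (v : TangentSpace I x) :
    S.inducedPhi a x v = -coneUnitProj I x (S.J a (coneUnit x) (coneUnitDeriv I x v)) := rfl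

/-- The Reeb field on the unit slice induced by a complex structure of the cone. -/
def inducedXi : SmoothVectorField I M :=
  -unitSliceField ((S.J a).appField (coneEuler I M))

theorem inducedXi_apply (x : M) :
    S.inducedXi a x = -coneUnitProj I x (S.J a (coneUnit x) (coneEuler I M (coneUnit x))) :=
  congrArg Neg.neg (coneUnitProj_apply x _).symm

theorem J_coneUnitDeriv (x : M) (v : TangentSpace I x) :
    S.J a (coneUnit x) (coneUnitDeriv I x v) = -coneUnitDeriv I x (S.inducedPhi a x v) +
      S.inducedEta a x v • coneEuler I M (coneUnit x) := by
  rw [inducedPhi_apply, inducedEta_apply, map_neg, neg_neg]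
  exact coneUnit_decomposition _ _

theorem inner_J_self (p : Cone M) (v : TangentSpace (coneModel I) p) :
    (coneMetric g).inner p v (S.J a p v) = 0 := by
  linarith [S.inner_J_swap a p v v]

theorem coneDr_J_coneEuler (p : Cone M) : coneDr I p (S.J a p (coneEuler I M p)) = 0 := by
  have h := S.inner_J_self a p (coneEuler I M p)
  rw [coneMetric_inner_coneEuler_left, ← coneDr_apply] at h
  exact (mul_eq_zero.1 h).resolve_left (coneRadius_pos p).ne'

theorem J_coneEuler (x : M) : S.J a (coneUnit x) (coneEuler I M (coneUnit x)) =
    -coneUnitDeriv I x (S.inducedXi a x) := by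
  rw [inducedXi_apply, map_neg, neg_neg]
  refine (coneUnit_decomposition _ _).trans ?_
  rw [coneDr_J_coneEuler, zero_smul, add_zero]

/-- The component along `M` of the quaternion relation on vectors tangent to the unit slice. -/
theorem inducedPhi_inducedPhi (a b : Fin 3) (x : M) (v : TangentSpace I x) :
    S.inducedPhi a x (S.inducedPhi b x v) - S.inducedEta b x v • S.inducedXi a x =
      -(∑ c, epsilonThree a b c • S.inducedPhi c x v) - (if a = b then v else 0) := by
  have h := congrArg (coneUnitProj I x) (S.quaternion a b (coneUnit x) (coneUnitDeriv I x v))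
  have e : (if a = b then coneUnitDeriv I x v else 0) =
      coneUnitDeriv I x (if a = b then v else 0) := by
    split_ifs <;> simp
  rw [e] at h
  simp only [J_coneUnitDeriv, J_coneEuler, map_add, map_neg, map_smul, map_sub, map_sum,
    coneUnitProj_coneUnitDeriv, coneUnitProj_coneEuler, smul_zero, add_zero, neg_neg,
    smul_neg, Finset.sum_neg_distrib] at h
  rw [sub_eq_add_neg]
  exact h

theorem inducedEta_inducedPhi (x : M) (v : TangentSpace I x) :
    S.inducedEta a x (S.inducedPhi a x v) = 0 := by
  have h := congrArg (coneDr I (coneUnit x)) (S.J_sq a (coneUnit x) (coneUnitDeriv I x v))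
  simp only [J_coneUnitDeriv, J_coneEuler, map_add, map_neg, map_smul,
    coneDr_coneUnitDeriv, coneDr_coneEuler, coneRadius_coneUnit, neg_zero,
    smul_eq_mul, mul_one, zero_add] at h
  linarith

theorem inducedEta_inducedXi (x : M) : S.inducedEta a x (S.inducedXi a x) = 1 := by
  have h := congrArg (coneDr I (coneUnit x)) (S.J_sq a (coneUnit x) (coneEuler I M (coneUnit x)))
  simp only [J_coneUnitDeriv, J_coneEuler, map_add, map_neg, map_smul,
    coneDr_coneUnitDeriv, coneDr_coneEuler, coneRadius_coneUnit, neg_zero,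
    smul_eq_mul, mul_one, zero_add] at h
  linarith

theorem inducedPhi_sq (x : M) (v : TangentSpace I x) :
    S.inducedPhi a x (S.inducedPhi a x v) = -v + S.inducedEta a x v • S.inducedXi a x := by
  have h := S.inducedPhi_inducedPhi a a x v
  simp only [epsilonThree_self, zero_smul, Finset.sum_const_zero, if_true, neg_zero,
    zero_sub] at h
  rw [← h, sub_add_cancel]

theorem inner_inducedPhi (x : M) (v w : TangentSpace I x) :
    g.inner x (S.inducedPhi a x v) (S.inducedPhi a x w) =
      g.inner x v w - S.inducedEta a x v * S.inducedEta a x w := by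
  have h := S.orthogonal a (coneUnit x) (coneUnitDeriv I x v) (coneUnitDeriv I x w)
  rw [coneMetric_inner_coneUnit, coneMetric_inner_coneUnit] at h
  simp only [J_coneUnitDeriv, map_add, map_neg, map_smul,
    coneDr_coneUnitDeriv, coneDr_coneEuler, coneRadius_coneUnit, coneUnitProj_coneUnitDeriv,
    coneUnitProj_coneEuler, smul_zero, add_zero, neg_zero, smul_eq_mul, mul_one, zero_add,
    neg_apply, neg_neg, mul_zero] at h
  linarith

theorem inner_inducedXi (x : M) (v : TangentSpace I x) :
    g.inner x v (S.inducedXi a x) = S.inducedEta a x v := by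
  have h := S.inner_J_left a (coneUnit x) (coneUnitDeriv I x v) (coneEuler I M (coneUnit x))
  rw [coneMetric_inner_coneUnit, coneMetric_inner_coneUnit] at h
  simp only [J_coneUnitDeriv, J_coneEuler, map_add, map_neg, map_smul,
    coneDr_coneUnitDeriv, coneDr_coneEuler, coneRadius_coneUnit, coneUnitProj_coneUnitDeriv,
    coneUnitProj_coneEuler, smul_zero, add_zero, neg_zero, smul_eq_mul, mul_one, zero_add,
    map_zero, neg_neg, mul_zero] at h
  exact h.symm

/-- `η` is the restriction of `V ⌟ ω` to the unit slice, so `dη` is the restriction of `d(V ⌟ ω) =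
2ω`. -/
theorem extDerivOne_inducedEta (X Y : SmoothVectorField I M) (x : M) :
    extDerivOne (S.inducedEta a) X Y x = -(2 * g.inner x (X x) (S.inducedPhi a x (Y x))) := by
  have h := S.extDerivEuler_eq_two_mul a (coneLift X) (coneLift Y) (coneUnit x)
  have sm (Z : SmoothVectorField I M) := contMDiff_metric_apply (coneMetric g) (coneEuler I M)
    ((S.J a).appField (coneLift Z))
  have e (Z : SmoothVectorField I M) (y : M) :
      (coneMetric g).inner (coneUnit y) (coneEuler I M (coneUnit y))
        (S.J a (coneUnit y) (coneLift Z (coneUnit y))) = S.inducedEta a y (Z y) := by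
    rw [coneMetric_inner_coneEuler_left, coneRadius_coneUnit, one_mul, ← coneDr_apply]
    rfl
  rw [extDerivEuler, coneLift_bracket, e] at h
  have d (Z W : SmoothVectorField I M) := (dirDeriv_coneLift_coneUnit Z (sm W) (x := x)).trans
    (congrArg (fun f ↦ dirDeriv Z f x) (funext (e W)))
  rw [extDerivOne, ← SmoothVectorField.coe_bracket]
  refine Eq.trans ?_ (h.trans ?_)
  · exact congrArg₂ (fun s t ↦ s - t - _) (d X Y).symm (d Y X).symm
  · rw [coneLift_coneUnit, coneLift_coneUnit, J_coneUnitDeriv, coneMetric_inner_coneUnit]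
    simp only [map_add, map_neg, map_smul, coneDr_coneUnitDeriv, coneUnitProj_coneUnitDeriv,
      coneUnitProj_coneEuler, smul_zero, add_zero, zero_mul, zero_add]
    ring

/-- The contact metric structure on the base induced by a complex structure of the cone. -/
def inducedContact : ContactMetricStructure g where
  eta := S.inducedEta a
  xi := S.inducedXi a
  Phi := S.inducedPhi a
  isContactForm x := by
    refine ⟨fun h ↦ ?_, fun X hX h ↦ ?_⟩
    · have := S.inducedEta_inducedXi a x
      rw [h] at this
      exact zero_ne_one this
    -- Testing against `ΦX` gives `dη(X, ΦX) = 2 g(X, X)` when `η(X) = 0`.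
    · have h1 := h ((S.inducedPhi a).appField X) (S.inducedEta_inducedPhi a x (X x))
      rw [extDerivOne_inducedEta, SmoothEndField.appField_apply, inducedPhi_sq, hX, zero_smul,
        add_zero, map_neg] at h1
      by_contra hne
      linarith [g.pos x _ hne]
  eta_xi := S.inducedEta_inducedXi a
  reeb X x := by
    rw [extDerivOne_inducedEta, g.symm, inner_inducedXi, inducedEta_inducedPhi]
    simp
  Phi_sq := S.inducedPhi_sq a
  compatible := S.inner_inducedPhi a
  associated X Y x := by
    rw [← SmoothEndField.coe_appField, extDerivOne_inducedEta, SmoothEndField.appField_apply,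
      inducedPhi_sq, map_add, map_neg, map_smul, inner_inducedXi, smul_eq_mul]
    ring

/-- The contact 3-structure on the base induced by a hyperkähler structure of the cone. -/
def inducedContactThree : ContactThreeStructure g where
  str := S.inducedContact
  relations := S.inducedPhi_inducedPhi

/-- Both `J` and the lift are invariant under `V`, so the decomposition of `JX` on the unit slice
persists along the whole cone. Brackets need this, since values on the slice alone do not determine
them. -/
theorem J_coneLift (X : SmoothVectorField I M) :
    (S.J a).appField (coneLift X) = coneLiftAdd (-(S.inducedPhi a).appField X)
      (fun x ↦ S.inducedEta a x (X x)) ((S.inducedEta a).contMDiff_apply X.contMDiff) := by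
  have hW : (coneEuler I M).bracket ((S.J a).appField (coneLift X)) = 0 :=
    ContMDiffSection.ext fun p ↦ by
      rw [S.coneEuler_bracket_J, coneEuler_bracket_coneLift]
      exact map_zero (S.J a p)
  have e : unitSliceField ((S.J a).appField (coneLift X)) = -(S.inducedPhi a).appField X :=
    ContMDiffSection.ext fun x ↦ by
      refine (coneUnitProj_apply x _).symm.trans ?_
      change _ = - S.inducedPhi a x (X x)
      rw [inducedPhi_apply, neg_neg]
      rfl
  refine ContMDiffSection.ext fun p ↦ ?_
  rw [coneField_eq_of_bracket g hW p, e, coneLiftAdd_apply]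
  rfl

/-- The complex structures of a hyperkähler cone induce normal contact structures. -/
theorem inducedContact_isNormal : (S.inducedContact a).IsNormal := by
  intro X Y x
  -- Projecting integrability on lifts to `M`: the terms `X η(Y)` and `Y η(X)` appear as
  -- coefficients of `J V = -ξ`.
  have hN := congrArg (coneUnitProj I x)
    (S.nijenhuis_eq_zero a (coneLift X) (coneLift Y) (coneUnit x))
  rw [nijenhuis, S.J_sq] at hN
  simp only [← SmoothEndField.coe_appField, ← SmoothVectorField.coe_bracket] at hN
  rw [J_coneLift, J_coneLift, coneLift_bracket, coneLift_eq_coneLiftAdd X,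
    coneLift_eq_coneLiftAdd Y, coneLiftAdd_bracket, coneLiftAdd_bracket,
    coneLiftAdd_bracket] at hN
  have n1 (A B : SmoothVectorField I M) : A.bracket (-B) = -(A.bracket B) :=
    ContMDiffSection.ext fun y ↦ by
      have h := VectorField.mlieBracket_const_smul_right (V := A) (B.mdiffAt y) (c := (-1 : ℝ))
      rw [neg_one_smul, neg_one_smul] at h
      exact h
  have n2 (A B : SmoothVectorField I M) : (-A).bracket B = -(A.bracket B) :=
    ContMDiffSection.ext fun y ↦ by
      have h := VectorField.mlieBracket_const_smul_left (W := B) (A.mdiffAt y) (c := (-1 : ℝ))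
      rw [neg_one_smul, neg_one_smul] at h
      exact h
  have ex : (coneUnit x).1 = x := rfl
  simp only [n1, n2, neg_neg, dirDeriv_const, ex, sub_zero, zero_sub, coneLift_coneUnit, map_add,
    map_sub, map_neg, map_smul, J_coneUnitDeriv, J_coneEuler, coneUnitProj_coneUnitDeriv,
    coneUnitProj_coneEuler, smul_zero, add_zero, ContMDiffSection.coe_neg, Pi.neg_apply,
    map_zero] at hN
  change VectorField.mlieBracket I _ _ x + S.inducedPhi a x (S.inducedPhi a x _)
    - S.inducedPhi a x _ - S.inducedPhi a x _ = -(_ • S.inducedXi a x)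
  -- `J² = -id`, whereas `Φ² = -id + ξ ⊗ η`; the difference supplies the `η([X, Y]) ξ` part of
  -- `-dη(X, Y) ξ`.
  rw [inducedPhi_sq, ← sub_eq_zero]
  have hd : extDerivOne (S.inducedContact a).eta X Y x =
    dirDeriv X (fun y ↦ S.inducedEta a y (Y y)) x
    - dirDeriv Y (fun y ↦ S.inducedEta a y (X y)) x - S.inducedEta a x (X.bracket Y x) := rfl
  rw [hd]
  refine Eq.trans ?_ hN
  simp only [inducedContact, ← SmoothEndField.coe_appField, ← SmoothVectorField.coe_bracket]
  module

end AlmostHyperkahlerStructure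

/-- If the cone over `(M, g)` is almost hyperkähler, then `(M, g)` is 3-Sasakian. -/
theorem isThreeSasakian_of_isAlmostHyperkahler (h : IsAlmostHyperkahler (coneMetric g)) :
    IsThreeSasakian g := by
  obtain ⟨S⟩ := h
  exact ⟨S.inducedContactThree, S.inducedContact_isNormal⟩

theorem isHyperkahler_of_isAlmostHyperkahler
    {g : Bundle.ContMDiffRiemannianMetric I ∞ E (fun x : M ↦ TangentSpace I x)}
    (h : IsAlmostHyperkahler g) : IsHyperkahler g := by
  obtain ⟨S⟩ := h
  exact ⟨S, S.nijenhuis_eq_zero⟩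

end InducedContact

end

theorem proposition8p1 (n : ℕ) (M : Type*) [TopologicalSpace M] [T2Space M]
    [SecondCountableTopology M] [ChartedSpace (EuclideanSpace ℝ (Fin n)) M] [IsManifold (𝓡 n) ∞ M]
    (g : Bundle.ContMDiffRiemannianMetric (𝓡 n) ∞ (EuclideanSpace ℝ (Fin n))
      (fun x : M ↦ TangentSpace (𝓡 n) x)) :
    (HasContactThreeStructure g ↔ IsAlmostHyperkahler (coneMetric g)) ∧
      (IsThreeSasakian g ↔ IsHyperkahler (coneMetric g)) := by
  have sasakian (h : IsAlmostHyperkahler (coneMetric g)) : IsThreeSasakian g :=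
    isThreeSasakian_of_isAlmostHyperkahler h
  have contact (h : IsThreeSasakian g) : HasContactThreeStructure g := ⟨h.choose⟩
  exact ⟨⟨isAlmostHyperkahler_coneMetric, fun h ↦ contact (sasakian h)⟩,
    fun h ↦ isHyperkahler_of_isAlmostHyperkahler (isAlmostHyperkahler_coneMetric (contact h)),
    fun h ↦ sasakian ⟨h.choose⟩⟩
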